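/- Let $n\ge 2$ and let $P(z)=\sum_{k=0}^n \lambda_k z^k$, where $\lambda=(\lambda_0,\dots,\lambda_n)$ is a random vector in $\mathbb C^{n+1}$. Given random vectors $\lambda',\lambda''$ in $\mathbb C^{n+1}$ on a common probability space, put $\lambda_k^+=\lambda_k'$, $\lambda_k^-=\lambda_k''$; their joint law is called flip-invariant if the random vectors $\lambda^\sigma=(\lambda_0^{\sigma_0},\dots,\lambda_n^{\sigma_n})$, $\sigma\in\{+,-\}^{n+1}$, all have the same distribution. The coefficients of $P$ have property $(\Theta)$ if there exist random vectors $\lambda',\lambda''$ on a common probability space, each equidistributed with $\lambda$, with flip-invariant joint law, such that for some $a\in\mathbb C$ and every $k\in\{0,\dots,n\}$, \[ |\lambda_k'-\lambda_k''|\ \ge\ \tfrac12\bigl[\,|\lambda_k'-a|+|\lambda_k''-a|\,\bigr]\qquad\text{a.s.} \] Let $V(P)$ be the number of vertices on the graph of the convex polygonal function $t\mapsto\max_{0\le k\le n}(\log|\lambda_k|+kt)$, $t\in\mathbb R$ (with $\log 0=-\infty$). For $L\ge 0$, an $L$-Lipschitz curve is a set $\Gamma=\{re^{{\rm i}\theta(r)}\colon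 0\le r<\infty\}\subset\mathbb C$, where $\theta$ is a real-valued function with $|\theta(r_1)-\theta(r_2)|\le L\,|\log(r_1/r_2)|$ for all $r_1,r_2>0$; $N(\Gamma;P)$ is the number of zeroes of $P$ on $\Gamma$, counted with multiplicities. Theorem. For every $A>0$ and $L\ge 0$ there is a constant $C(A,L)>0$, depending only on $A$ and $L$, such that for every $n\ge 2$ and every random polynomial $P$ of degree $n$ as above whose coefficients have property $(\Theta)$ and satisfy $\mathbb P\{\lambda_0=0\}=\mathbb P\{\lambda_n=0\}=0$, with probability at least $1-n^{-A}$, \[ \sup\bigl\{N(\Gamma;P)\colon \Gamma\ \text{is } L\text{-Lipschitz}\bigr\}\ \le\ C(A,L)\,V(P)\,\log^3 n . \] -/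

import Mathlib

open MeasureTheory ProbabilityTheory

noncomputable section

namespace RandomPoly

/-- The polynomial `∑_{k=0}^n λ_k z^k` with coefficient vector `λ ∈ ℂ^{n+1}`. -/
def poly {n : ℕ} (lam : Fin (n + 1) → ℂ) : Polynomial ℂ :=
  ∑ k : Fin (n + 1), Polynomial.C (lam k) * Polynomial.X ^ (k : ℕ)

/-- The convex polygonal function `t ↦ max_k (log |λ_k| + k t)`. Since `log 0 = -∞`, the indices
with `λ_k = 0` do not take part in the maximum. -/
def envelope {n : ℕ} (lam : Fin (n + 1) → ℂ) (t : ℝ) : ℝ :=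
  ⨆ k : {k : Fin (n + 1) // lam k ≠ 0}, (Real.log ‖lam k‖ + ((k : Fin (n + 1)) : ℕ) * t)

/-- `V(P)`: the number of vertices (points where the slope changes) on the graph of the
polygonal function `t ↦ max_k (log |λ_k| + k t)`. -/
def numVertices {n : ℕ} (lam : Fin (n + 1) → ℂ) : ℕ :=
  {t : ℝ | ¬ DifferentiableAt ℝ (envelope lam) t}.ncard

/-- `Γ = {r e^{iθ(r)} : 0 ≤ r < ∞}` with `|θ(r₁) - θ(r₂)| ≤ L |log (r₁ / r₂)|`. (For `r₁ = 0` or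
`r₂ = 0` the right-hand side is infinite, so only positive radii give a condition.) -/
def IsLipschitzCurve (L : ℝ) (Γ : Set ℂ) : Prop :=
  ∃ θ : ℝ → ℝ,
    (∀ r₁ r₂ : ℝ, 0 < r₁ → 0 < r₂ → |θ r₁ - θ r₂| ≤ L * |Real.log (r₁ / r₂)|) ∧
    Γ = {z : ℂ | ∃ r : ℝ, 0 ≤ r ∧ z = (r : ℂ) * Complex.exp ((θ r : ℂ) * Complex.I)}

open scoped Classical in
/-- `N(Γ; P)`: the number of zeroes of the (nonzero) polynomial `P` on `Γ`, counted with
multiplicities. -/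
def numZerosOn (Γ : Set ℂ) (P : Polynomial ℂ) : ℕ :=
  (P.roots.filter (fun z => z ∈ Γ)).card

/-- `λ^σ = (λ_0^{σ_0}, …, λ_n^{σ_n})`, where `λ_k^+ = λ'_k` and `λ_k^- = λ''_k`; the sign `+` is
encoded as `true`. -/
def flip {Ω : Type*} {n : ℕ} (lam' lam'' : Ω → Fin (n + 1) → ℂ) (σ : Fin (n + 1) → Bool) :
    Ω → Fin (n + 1) → ℂ :=
  fun ω k => if σ k then lam' ω k else lam'' ω k

/-- The joint law of `λ'` and `λ''` is flip-invariant: all the `λ^σ` are equidistributed. -/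
def FlipInvariant {Ω : Type*} [MeasurableSpace Ω] {n : ℕ} (ρ : Measure Ω)
    (lam' lam'' : Ω → Fin (n + 1) → ℂ) : Prop :=
  ∀ σ τ : Fin (n + 1) → Bool, IdentDistrib (flip lam' lam'' σ) (flip lam' lam'' τ) ρ ρ

/-- Property `(Θ)` of the distribution of `λ` under `μ`. The random vectors `λ'`, `λ''` live on
some auxiliary probability space. `IdentDistrib` includes a.e.-measurability of both sides. -/
def PropertyTheta {Ω : Type*} [MeasurableSpace Ω] {n : ℕ} (μ : Measure Ω)
    (lam : Ω → Fin (n + 1) → ℂ) : Prop :=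
  ∃ (Ω' : Type) (_ : MeasurableSpace Ω') (ρ : Measure Ω') (_ : IsProbabilityMeasure ρ)
    (lam' lam'' : Ω' → Fin (n + 1) → ℂ),
    IdentDistrib lam' lam ρ μ ∧ IdentDistrib lam'' lam ρ μ ∧
    FlipInvariant ρ lam' lam'' ∧
    ∃ a : ℂ, ∀ k : Fin (n + 1), ∀ᵐ ω ∂ρ,
      (1 / 2 : ℝ) * (‖lam' ω k - a‖ + ‖lam'' ω k - a‖) ≤ ‖lam' ω k - lam'' ω k‖

end RandomPoly

end

/-!
Write `z = e^{t + iθ}` and `S(t) = ∑ |λ_k| e^{kt}` (`coeffSum`). Up to an error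
`log (n + 1)`, `log S` is the polygonal function whose vertices are counted by `V(P)`.

**Where the zeros are.** At distance more than `2` from all the vertices one term of `P` exceeds the
sum of the others (`exists_vertex_near_root`). The strip of width `4` around a vertex is cut into
`O(log n)` annuli of geometrically decreasing width, down to the scale `1 / n` at the vertex. On
each of them, and on a dilated annulus, `S` behaves like a monomial, either because no vertex is
close or because the width is at most of order `1 / n` (`exists_annulus`). A Lipschitz curve passes
through `O(L + 1)` discs of diameter comparable with the width of the annulus. A Jensen-type
estimate (`two_pow_card_roots_mul_le`) bounds the number of zeros in a disc by the logarithm of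
`S(t) / |P(w)|`, for any `w` on the circle `|w| = e^t` near the centre. So `O(log² n)` zeros in each
disc, hence the theorem, follow from a lower bound `|P(w)| ≥ exp (-O(log² n)) S(t)`
(`IsLargeNear`).

**Why `P` is not small.** By flip-invariance it suffices to fix `λ'` and `λ''` and to count the
signs `σ` for which `P_{λ^σ}` is small (`measure_not_isGood_mul_le`). The tool is a weak form of
Turán's lemma (`norm_coeff_le_of_norm_sum_pow_le`): a polynomial with `m` terms that is small at `m`
consecutive points of a grid on the circle, of step about `n⁻²`, has coefficients larger than the
values by at most the factor `n^{O(m)}`. Let `T` be the set of the `m` largest among the numbers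
`|λ'_k - λ''_k| e^{kt}`, with `m` of order `log n`. Two sign vectors that agree off `T` give
polynomials whose difference has exponents in `T`, so at most one of them can be small compared
with the least of these `m` numbers; the bad proportion is at most `2^{-m}`, a power of `1 / n`
(`card_flip_small_mul_le`). If that least number is itself negligible compared with `S(t)`, then by
property `(Θ)` all the coefficients off `T` are nearly equal to `a`, so `(1 - z) P(z)` is nearly a
polynomial with `2 m + 2` terms, and the weak Turán lemma bounds `S(t)` by the values of `P`
(`coeffSum_le_of_near_constant`).

The radii concerned depend on `σ` through the vertices. But every vertex is a crossing of two lines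
`log |λ_k| + k t`, and there are only `O(n²)` crossings over all `σ`, so a union bound over circles
and grid points costs a power of `n` (`card_not_isGood_mul_le`).
-/

/-! ### A weak form of Turán's lemma -/

namespace RandomPoly

/-- A weak Turán lemma: the coefficients of an exponential sum with `m + 1` well-separated
frequencies are controlled by `m + 1` consecutive values of the sum. The operator
`a ↦ (s ↦ a (s + 1) - u l * a s)` removes the frequency `u l`, so the other frequencies can be
removed one at a time. -/
theorem norm_coeff_le_of_norm_sum_pow_le {ι : Type*} [DecidableEq ι] (u : ι → ℂ) {ρ : ℝ}
    (hρ : 0 < ρ) (m : ℕ) : ∀ (T : Finset ι) (c : ι → ℂ) (B : ℝ), T.card = m + 1 →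
      (∀ k ∈ T, ‖u k‖ ≤ 1) →
      (∀ k ∈ T, ∀ l ∈ T, k ≠ l → ρ ≤ ‖u k - u l‖) →
      (∀ s < m + 1, ‖∑ k ∈ T, c k * u k ^ s‖ ≤ B) →
      ∀ k ∈ T, ‖c k‖ ≤ (2 / ρ) ^ m * B := by
  induction m with
  | zero =>
    intro T c B hT _ _ hB k hk
    obtain ⟨x, rfl⟩ := Finset.card_eq_one.1 hT
    obtain rfl := Finset.mem_singleton.1 hk
    simpa using hB 0 (by norm_num)
  | succ m ih =>
    intro T c B hT hu hsep hB k hk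
    obtain ⟨l, hl, hlk⟩ := T.exists_mem_ne (by omega) k
    have hsum : ∀ s, ∑ j ∈ T.erase l, (c j * (u j - u l)) * u j ^ s
        = ∑ j ∈ T, c j * u j ^ (s + 1) - u l * ∑ j ∈ T, c j * u j ^ s := by
      intro s
      rw [Finset.mul_sum, ← Finset.sum_sub_distrib, Finset.sum_erase T (by simp)]
      exact Finset.sum_congr rfl fun j _ => by ring
    have h := ih (T.erase l) (fun j => c j * (u j - u l)) (2 * B)
      (by rw [Finset.card_erase_of_mem hl, hT]; rfl)
      (fun j hj => hu j (Finset.mem_of_mem_erase hj))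
      (fun i hi j hj => hsep i (Finset.mem_of_mem_erase hi) j (Finset.mem_of_mem_erase hj))
      (fun s hs => by
        rw [hsum]
        have h1 := hB (s + 1) (by omega)
        have h2 := hB s (by omega)
        have h3 : ‖u l * ∑ j ∈ T, c j * u j ^ s‖ ≤ B := by
          rw [norm_mul]
          exact (mul_le_of_le_one_left (norm_nonneg _) (hu l hl)).trans h2
        exact (norm_sub_le _ _).trans (by linarith))
      k (Finset.mem_erase.2 ⟨hlk.symm, hk⟩)
    rw [norm_mul] at h
    have h4 : ‖c k‖ * ρ ≤ (2 / ρ) ^ m * (2 * B) :=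
      (mul_le_mul_of_nonneg_left (hsep k hk l hl hlk.symm) (norm_nonneg _)).trans h
    calc ‖c k‖ ≤ (2 / ρ) ^ m * (2 * B) / ρ := (le_div_iff₀ hρ).2 h4
      _ = (2 / ρ) ^ (m + 1) * B := by rw [pow_succ]; ring

/-- The `j`-th point `e^{t + 2πij/K}` of the uniform grid of `K` points on the circle of radius
`e^t`. -/
noncomputable def gridPoint (K : ℕ) (t : ℝ) (j : ℕ) : ℂ :=
  Complex.exp ((t : ℂ) + ((2 * Real.pi * j / K : ℝ) : ℂ) * Complex.I)

theorem norm_gridPoint (K : ℕ) (t : ℝ) (j : ℕ) : ‖gridPoint K t j‖ = Real.exp t := by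
  simp [gridPoint, Complex.norm_exp]

theorem gridPoint_add_pow (K : ℕ) (t : ℝ) (i s k : ℕ) :
    gridPoint K t (i + s) ^ k = gridPoint K t i ^ k * gridPoint K 0 k ^ s := by
  simp only [gridPoint, ← Complex.exp_nat_mul, ← Complex.exp_add]
  congr 1
  push_cast
  ring

theorem norm_gridPoint_zero (K j : ℕ) : ‖gridPoint K 0 j‖ = 1 := by
  simp [norm_gridPoint]

theorem two_div_le_norm_gridPoint_sub {K k l : ℕ} (hk : 2 * k ≤ K) (hl : 2 * l ≤ K)
    (hkl : k ≠ l) : 2 / (K : ℝ) ≤ ‖gridPoint K 0 k - gridPoint K 0 l‖ := by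
  have hK : (0 : ℝ) < K := by
    have : 0 < K := by omega
    exact_mod_cast this
  have h1 : gridPoint K 0 k - gridPoint K 0 l = gridPoint K 0 l *
      (Complex.exp (Complex.I * ((2 * Real.pi * ((k : ℝ) - l) / K : ℝ) : ℂ)) - 1) := by
    rw [mul_sub, mul_one]
    simp only [gridPoint, ← Complex.exp_add]
    congr 2
    push_cast
    ring
  rw [h1, norm_mul, norm_gridPoint_zero, one_mul, Complex.norm_exp_I_mul_ofReal_sub_one,
    Real.norm_eq_abs, abs_mul, abs_two]
  have h2 : 2 * Real.pi * ((k : ℝ) - l) / K / 2 = Real.pi * (((k : ℝ) - l) / K) := by ring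
  have h3 : |((k : ℝ) - l) / K| ≤ 1 / 2 := by
    rw [abs_div, abs_of_pos hK, div_le_iff₀ hK, abs_le]
    have hk' : (2 : ℝ) * k ≤ K := by exact_mod_cast hk
    have hl' : (2 : ℝ) * l ≤ K := by exact_mod_cast hl
    have := (k : ℕ).cast_nonneg (α := ℝ)
    have := (l : ℕ).cast_nonneg (α := ℝ)
    constructor <;> linarith
  have h4 : 1 / (K : ℝ) ≤ |((k : ℝ) - l) / K| := by
    rw [abs_div, abs_of_pos hK]
    gcongr
    have : (1 : ℤ) ≤ |(k : ℤ) - l| := Int.one_le_abs (by omega)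
    exact_mod_cast this
  have h5 := Real.mul_abs_le_abs_sin (x := Real.pi * (((k : ℝ) - l) / K)) (by
    rw [abs_mul, abs_of_pos Real.pi_pos]
    nlinarith [Real.pi_pos])
  rw [h2]
  rw [abs_mul, abs_of_pos Real.pi_pos] at h5
  have h6 : 2 / Real.pi * (Real.pi * |((k : ℝ) - l) / K|) = 2 * |((k : ℝ) - l) / K| := by
    field_simp
  rw [h6] at h5
  have : 2 / (K : ℝ) = 2 * (1 / K) := by ring
  linarith [abs_nonneg (((k : ℝ) - l) / K)]

/-- The weak Turán lemma on a circle: a polynomial whose exponents lie in a finite set `T` and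
which is small at `M ≥ #T` consecutive grid points has small coefficients. -/
theorem norm_coeff_mul_exp_le {K M N : ℕ} (hK : 2 * N ≤ K) (hK1 : 1 ≤ K) (T : Finset ℕ)
    (hTN : ∀ k ∈ T, k ≤ N) (hTM : T.card ≤ M) (c : ℕ → ℂ) (t : ℝ) (i : ℕ) {B : ℝ}
    (hB : ∀ s < M, ‖∑ k ∈ T, c k * gridPoint K t (i + s) ^ k‖ ≤ B) {k : ℕ} (hk : k ∈ T) :
    ‖c k‖ * Real.exp (k * t) ≤ (K : ℝ) ^ (M - 1) * B := by
  have hcard : T.card = (T.card - 1) + 1 := by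
    have := Finset.card_pos.2 ⟨k, hk⟩
    omega
  have hK1' : (1 : ℝ) ≤ K := by exact_mod_cast hK1
  have hK0 : (0 : ℝ) < K := by linarith
  have h := norm_coeff_le_of_norm_sum_pow_le (gridPoint K 0) (ρ := 2 / K) (by positivity)
    (T.card - 1) T (fun k => c k * gridPoint K t i ^ k) B hcard
    (fun k _ => (norm_gridPoint_zero K k).le)
    (fun k hk l hl hkl => two_div_le_norm_gridPoint_sub
      ((Nat.mul_le_mul_left 2 (hTN k hk)).trans hK)
      ((Nat.mul_le_mul_left 2 (hTN l hl)).trans hK) hkl)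
    (fun s hs => by
      have := hB s (by omega)
      simpa only [gridPoint_add_pow, mul_assoc] using this) k hk
  have hB0 : 0 ≤ B := (norm_nonneg _).trans (hB 0 (by omega))
  rw [norm_mul, norm_pow, norm_gridPoint, ← Real.exp_nat_mul] at h
  refine h.trans (mul_le_mul_of_nonneg_right ?_ hB0)
  have : 2 / (2 / (K : ℝ)) = K := by field_simp
  rw [this]
  exact pow_le_pow_right₀ hK1' (by omega)

/-! ### Small values of a randomly flipped polynomial -/

theorem eval_poly {n : ℕ} (lam : Fin (n + 1) → ℂ) (z : ℂ) :
    (poly lam).eval z = ∑ k : Fin (n + 1), lam k * z ^ (k : ℕ) := by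
  simp [poly, Polynomial.eval_finsetSum]

theorem eval_zero_poly {n : ℕ} (lam : Fin (n + 1) → ℂ) : (poly lam).eval 0 = lam 0 := by
  rw [eval_poly, Finset.sum_eq_single 0]
  · simp
  · intro k _ hk
    have : (k : ℕ) ≠ 0 := fun h => hk (Fin.ext h)
    simp [this]
  · simp

/-- The sum `∑ |λ_k| e^{kt}`, which majorizes `|P|` on the circle of radius `e^t` and is comparable
with the largest term of `P` there up to the factor `n + 1`. -/
noncomputable def coeffSum {n : ℕ} (lam : Fin (n + 1) → ℂ) (t : ℝ) : ℝ :=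
  ∑ k : Fin (n + 1), ‖lam k‖ * Real.exp ((k : ℕ) * t)

/-- The vector `λ^σ` built from two deterministic vectors `λ'` and `λ''`. -/
def mix {n : ℕ} (lam' lam'' : Fin (n + 1) → ℂ) (σ : Fin (n + 1) → Bool) : Fin (n + 1) → ℂ :=
  fun k => if σ k then lam' k else lam'' k

theorem norm_mix_sub_mix {n : ℕ} (lam' lam'' : Fin (n + 1) → ℂ) {σ σ' : Fin (n + 1) → Bool}
    {k : Fin (n + 1)} (h : σ k ≠ σ' k) :
    ‖mix lam' lam'' σ k - mix lam' lam'' σ' k‖ = ‖lam' k - lam'' k‖ := by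
  unfold mix
  cases h1 : σ k <;> cases h2 : σ' k <;> simp_all [norm_sub_rev]

/-- If `λ'` and `λ''` differ substantially on the index set `T`, then all but a proportion
`2^{-#T}` of the polynomials `P_{λ^σ}` are not small at one of `#T` consecutive grid points: by the
weak Turán lemma, two small ones cannot agree off `T`, since their difference would be a small
polynomial with exponents in `T`. -/
theorem card_flip_small_mul_le {n : ℕ} (lam' lam'' : Fin (n + 1) → ℂ) {K : ℕ} (hK : 2 * (n + 1) ≤ K)
    (t : ℝ) (i : ℕ) (T : Finset (Fin (n + 1))) (τ : ℝ)
    (hT : ∀ k ∈ T, τ ≤ ‖lam' k - lam'' k‖ * Real.exp ((k : ℕ) * t)) (hT0 : T.Nonempty) :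
    {σ : Fin (n + 1) → Bool | ∀ s < T.card,
      ‖(poly (mix lam' lam'' σ)).eval (gridPoint K t (i + s))‖
        < τ / (2 * (K : ℝ) ^ T.card)}.ncard * 2 ^ T.card ≤ 2 ^ (n + 1) := by
  classical
  set bad := {σ : Fin (n + 1) → Bool | ∀ s < T.card,
      ‖(poly (mix lam' lam'' σ)).eval (gridPoint K t (i + s))‖ < τ / (2 * (K : ℝ) ^ T.card)}
    with hbad
  have hK1 : (1 : ℝ) ≤ K := by
    have : 1 ≤ K := by omega
    exact_mod_cast this
  have hinj : Set.InjOn (fun (σ : Fin (n + 1) → Bool) (k : {k // k ∉ T}) => σ k) bad := by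
    intro σ hσ σ' hσ' heq
    by_contra hne
    obtain ⟨k₀, hk₀⟩ := Function.ne_iff.1 hne
    have hoff : ∀ k ∉ T, σ k = σ' k := fun k hk => congr_fun heq ⟨k, hk⟩
    have hk₀T : k₀ ∈ T := by
      by_contra h
      exact hk₀ (hoff k₀ h)
    have hpos : 0 < T.card := Finset.card_pos.2 hT0
    have hτ : 0 < τ := by
      have h := (norm_nonneg _).trans_lt (hσ 0 hpos)
      by_contra h'
      exact absurd h (not_lt.2 (div_nonpos_of_nonpos_of_nonneg (not_lt.1 h') (by positivity)))
    set d : Fin (n + 1) → ℂ := fun k => mix lam' lam'' σ k - mix lam' lam'' σ' k with hd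
    -- the difference of the two polynomials has exponents in `T`
    have hdiff : ∀ z : ℂ, (poly (mix lam' lam'' σ)).eval z - (poly (mix lam' lam'' σ')).eval z
        = ∑ k ∈ T.map Fin.valEmbedding,
            (fun j : ℕ => if h : j < n + 1 then d ⟨j, h⟩ else 0) k * z ^ k := by
      intro z
      rw [eval_poly, eval_poly, ← Finset.sum_sub_distrib, Finset.sum_map]
      rw [← Finset.sum_subset (Finset.subset_univ T)]
      · refine Finset.sum_congr rfl fun k _ => ?_
        simp [hd, sub_mul]
        exact fun h => absurd k.2 (by omega)
      · intro k _ hk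
        simp [mix, hoff k hk]
    have hsmall := norm_coeff_mul_exp_le (K := K) (N := n) (by omega) (by omega)
      (T.map Fin.valEmbedding)
      (by
        intro k hk
        obtain ⟨j, -, rfl⟩ := Finset.mem_map.1 hk
        exact Nat.lt_succ_iff.1 j.2)
      (by rw [Finset.card_map]) (fun j : ℕ => if h : j < n + 1 then d ⟨j, h⟩ else 0) t i
      (B := τ / (K : ℝ) ^ T.card)
      (by
        intro s hs
        rw [← hdiff]
        refine (norm_sub_le _ _).trans ?_
        have h1 := hσ s hs
        have h2 := hσ' s hs
        have h3 : τ / (K : ℝ) ^ T.card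
            = τ / (2 * (K : ℝ) ^ T.card) + τ / (2 * (K : ℝ) ^ T.card) := by
          field_simp
          norm_num
        linarith)
      (k := k₀) (Finset.mem_map.2 ⟨k₀, hk₀T, rfl⟩)
    have h1 := hT k₀ hk₀T
    rw [← norm_mix_sub_mix lam' lam'' hk₀] at h1
    simp only [Fin.is_lt, dif_pos, Fin.eta, hd] at hsmall
    have h2 : (K : ℝ) ^ (T.card - 1) * (τ / (K : ℝ) ^ T.card) < τ := by
      rw [mul_div_assoc', div_lt_iff₀ (by positivity), mul_comm]
      refine mul_lt_mul_of_pos_left ?_ hτ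
      refine pow_lt_pow_right₀ ?_ (by omega)
      have h3 : 1 < K := by omega
      exact_mod_cast h3
    linarith
  have hc : bad.ncard ≤ Fintype.card ({k // k ∉ T} → Bool) := by
    rw [← Nat.card_eq_fintype_card, ← Set.ncard_univ]
    exact Set.ncard_le_ncard_of_injOn _ (fun _ _ => Set.mem_univ _) hinj
  have hc2 : Fintype.card ({k // k ∉ T} → Bool) = 2 ^ (n + 1 - T.card) := by
    rw [Fintype.card_fun, Fintype.card_bool, Fintype.card_subtype_compl]
    simp
  have hTc : T.card ≤ n + 1 := by simpa using T.card_le_univ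
  calc bad.ncard * 2 ^ T.card ≤ 2 ^ (n + 1 - T.card) * 2 ^ T.card :=
        Nat.mul_le_mul_right _ (hc.trans hc2.le)
    _ = 2 ^ (n + 1) := by rw [← pow_add]; congr 1; omega

/-! ### Coefficients nearly equal to a constant -/

/-- Multiplication by `1 - z` turns a polynomial into the one with the differenced coefficients. -/
theorem one_sub_mul_sum_mul_pow (ν : ℕ → ℂ) (z : ℂ) (N : ℕ) (hν : ν N = 0) :
    (1 - z) * ∑ k ∈ Finset.range N, ν k * z ^ k
      = ∑ j ∈ Finset.range (N + 1), (ν j - if j = 0 then 0 else ν (j - 1)) * z ^ j := by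
  rw [sub_mul, one_mul]
  simp only [sub_mul, Finset.sum_sub_distrib]
  congr 1
  · rw [Finset.sum_range_succ, hν]; simp
  · rw [Finset.sum_range_succ']
    simp [Finset.mul_sum, pow_succ]
    exact Finset.sum_congr rfl fun k _ => by ring

/-- The coefficients are recovered from the differenced ones by summation from below when
`r = e^t ≤ 1` and from above when `r ≥ 1`; this explains the weight `max 1 r`. -/
theorem norm_mul_exp_mul_max_le (ν : ℕ → ℂ) (t : ℝ) (N : ℕ) (hν : ν N = 0) {k : ℕ} (hk : k < N) :
    ‖ν k‖ * Real.exp (k * t) * max 1 (Real.exp t)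
      ≤ ∑ j ∈ Finset.range (N + 1),
          ‖ν j - if j = 0 then 0 else ν (j - 1)‖ * Real.exp (j * t) := by
  set g : ℕ → ℂ := fun j => ν j - if j = 0 then 0 else ν (j - 1) with hg
  have hlow : ∀ m, ∑ j ∈ Finset.range (m + 1), g j = ν m := by
    intro m
    induction m with
    | zero => simp [hg]
    | succ m ih => rw [Finset.sum_range_succ, ih]; simp [hg]
  rcases le_total t 0 with ht | ht
  · rw [max_eq_left (Real.exp_le_one_iff.2 ht), mul_one, ← hlow k]
    calc ‖∑ j ∈ Finset.range (k + 1), g j‖ * Real.exp (k * t)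
        ≤ (∑ j ∈ Finset.range (k + 1), ‖g j‖) * Real.exp (k * t) := by
          gcongr; exact norm_sum_le _ _
      _ = ∑ j ∈ Finset.range (k + 1), ‖g j‖ * Real.exp (k * t) := Finset.sum_mul _ _ _
      _ ≤ ∑ j ∈ Finset.range (k + 1), ‖g j‖ * Real.exp (j * t) := by
          refine Finset.sum_le_sum fun j hj => ?_
          have : (j : ℝ) ≤ k := by
            exact_mod_cast Nat.lt_succ_iff.1 (Finset.mem_range.1 hj)
          gcongr ?_ * Real.exp ?_
          exact mul_le_mul_of_nonpos_right this ht
      _ ≤ _ := Finset.sum_le_sum_of_subset_of_nonneg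
          (Finset.range_subset_range.2 (by omega)) (fun _ _ _ => by positivity)
  · rw [max_eq_right (Real.one_le_exp ht), mul_assoc, ← Real.exp_add]
    have hhigh : -ν k = ∑ j ∈ Finset.Ico (k + 1) (N + 1), g j := by
      rw [Finset.sum_Ico_eq_sub _ (by omega), hlow, hlow, hν, zero_sub]
    rw [← norm_neg, hhigh]
    calc ‖∑ j ∈ Finset.Ico (k + 1) (N + 1), g j‖ * Real.exp (k * t + t)
        ≤ (∑ j ∈ Finset.Ico (k + 1) (N + 1), ‖g j‖) * Real.exp (k * t + t) := by
          gcongr; exact norm_sum_le _ _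
      _ = ∑ j ∈ Finset.Ico (k + 1) (N + 1), ‖g j‖ * Real.exp (k * t + t) := Finset.sum_mul _ _ _
      _ ≤ ∑ j ∈ Finset.Ico (k + 1) (N + 1), ‖g j‖ * Real.exp (j * t) := by
          refine Finset.sum_le_sum fun j hj => ?_
          have : (k : ℝ) + 1 ≤ j := by exact_mod_cast (Finset.mem_Ico.1 hj).1
          gcongr ?_ * Real.exp ?_
          nlinarith
      _ ≤ _ := Finset.sum_le_sum_of_subset_of_nonneg
          (fun j hj => Finset.mem_range.2 (Finset.mem_Ico.1 hj).2) (fun _ _ _ => by positivity)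

/-- If the coefficients of `P` outside `T` are almost equal to `a`, then `(1 - z) P(z)` is almost a
polynomial with at most `2 #T + 2` terms, and the weak Turán lemma bounds all the coefficients of
`P` by its values at `2 #T + 2` consecutive grid points. -/
theorem coeffSum_le_of_near_constant {n : ℕ} (lam : Fin (n + 1) → ℂ) (a : ℂ) {K : ℕ}
    (hK : 2 * (n + 2) ≤ K) (t : ℝ) (i : ℕ) (T : Finset (Fin (n + 1))) {τ B : ℝ} (hτ : 0 ≤ τ)
    (hT : ∀ k ∉ T, ‖lam k - a‖ * Real.exp ((k : ℕ) * t) ≤ 2 * τ)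
    (hB : ∀ s < 2 * T.card + 2, ‖(poly lam).eval (gridPoint K t (i + s))‖ ≤ B) :
    coeffSum lam t ≤ (K : ℝ) ^ (2 * T.card + 5) * (B + τ) := by
  classical
  have hB0 : 0 ≤ B := (norm_nonneg _).trans (hB 0 (by omega))
  have hKn : 2 * ((n : ℝ) + 2) ≤ K := by exact_mod_cast hK
  have hn0 : (0 : ℝ) ≤ n := n.cast_nonneg
  have hK1 : (1 : ℝ) ≤ K := by linarith
  set r := Real.exp t with hr
  set W := max 1 r with hW
  have hW1 : 1 ≤ W := le_max_left _ _
  set μ : Fin (n + 1) → ℂ := fun k => if k ∈ T then lam k else a with hμ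
  set ν : ℕ → ℂ := fun k => if h : k < n + 1 then μ ⟨k, h⟩ else 0 with hν
  have hνN : ν (n + 1) = 0 := by simp [hν]
  have hclose : ∀ k, ‖lam k - μ k‖ * Real.exp ((k : ℕ) * t) ≤ 2 * τ := by
    intro k
    by_cases hk : k ∈ T
    · simp [hμ, hk, hτ]
    · simpa [hμ, hk] using hT k hk
  have hνF₀ : ∀ k : Fin (n + 1), ν k = μ k := fun k => dif_pos k.2
  have hνF : ∀ z : ℂ, ∑ k ∈ Finset.range (n + 1), ν k * z ^ k
      = ∑ k : Fin (n + 1), μ k * z ^ (k : ℕ) := by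
    intro z
    rw [Finset.sum_range]
    exact Finset.sum_congr rfl fun k _ => by rw [hνF₀]
  set Γ := B + 2 * (n + 1) * τ with hΓ
  -- the approximating polynomial is small at the grid points
  have hQ : ∀ s < 2 * T.card + 2,
      ‖∑ k ∈ Finset.range (n + 1), ν k * gridPoint K t (i + s) ^ k‖ ≤ Γ := by
    intro s hs
    set z := gridPoint K t (i + s)
    have h1 : ∑ k ∈ Finset.range (n + 1), ν k * z ^ k
        = (poly lam).eval z - ∑ k : Fin (n + 1), (lam k - μ k) * z ^ (k : ℕ) := by
      rw [hνF, eval_poly, ← Finset.sum_sub_distrib]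
      exact Finset.sum_congr rfl fun k _ => by ring
    have h2 : ‖∑ k : Fin (n + 1), (lam k - μ k) * z ^ (k : ℕ)‖ ≤ (n + 1) * (2 * τ) := by
      refine (norm_sum_le _ _).trans ?_
      calc _ ≤ ∑ _k : Fin (n + 1), 2 * τ := by
            refine Finset.sum_le_sum fun k _ => ?_
            rw [norm_mul, norm_pow, norm_gridPoint, ← Real.exp_nat_mul]
            exact hclose k
        _ = (n + 1) * (2 * τ) := by simp
    rw [h1]
    refine (norm_sub_le _ _).trans ?_
    have := hB s hs
    rw [hΓ]
    linarith
  set g : ℕ → ℂ := fun j => ν j - if j = 0 then 0 else ν (j - 1) with hg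
  set U : Finset ℕ := {0, n + 1} ∪ (T.image (fun k : Fin (n + 1) => (k : ℕ)) ∪
    T.image (fun k : Fin (n + 1) => (k : ℕ) + 1)) with hU
  have hUc : U.card ≤ 2 * T.card + 2 := by
    refine (Finset.card_union_le _ _).trans ?_
    have h1 := Finset.card_union_le (T.image (fun k : Fin (n + 1) => (k : ℕ)))
      (T.image (fun k : Fin (n + 1) => (k : ℕ) + 1))
    have h2 := Finset.card_image_le (s := T) (f := fun k : Fin (n + 1) => (k : ℕ))
    have h3 := Finset.card_image_le (s := T) (f := fun k : Fin (n + 1) => (k : ℕ) + 1)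
    have h4 := Finset.card_le_two (a := 0) (b := n + 1)
    omega
  have hUle : ∀ k ∈ U, k ≤ n + 1 := by
    intro k hk
    simp only [hU, Finset.mem_union, Finset.mem_insert, Finset.mem_singleton,
      Finset.mem_image] at hk
    rcases hk with (rfl | rfl) | ⟨x, -, rfl⟩ | ⟨x, -, rfl⟩ <;> omega
  have hg0 : ∀ j < n + 2, j ∉ U → g j = 0 := by
    intro j hj hjU
    simp only [hU, Finset.mem_union, Finset.mem_insert, Finset.mem_singleton,
      Finset.mem_image, not_or, not_exists, not_and] at hjU
    obtain ⟨⟨h0, hn1⟩, hT1, hT2⟩ := hjU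
    have e1 : ν j = a := by
      have : (⟨j, by omega⟩ : Fin (n + 1)) ∉ T := fun h => hT1 _ h rfl
      exact (dif_pos (by omega)).trans (if_neg this)
    have e2 : ν (j - 1) = a := by
      have : (⟨j - 1, by omega⟩ : Fin (n + 1)) ∉ T := fun h => hT2 _ h (by simp; omega)
      exact (dif_pos (by omega)).trans (if_neg this)
    simp [hg, h0, e1, e2]
  have hGU : ∀ z : ℂ, ∑ j ∈ U, g j * z ^ j
      = (1 - z) * ∑ k ∈ Finset.range (n + 1), ν k * z ^ k := by
    intro z
    rw [one_sub_mul_sum_mul_pow ν z (n + 1) hνN]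
    refine Finset.sum_subset (fun j hj => Finset.mem_range.2 (by have := hUle j hj; omega)) ?_
    intro j hj hjU
    change g j * z ^ j = 0
    rw [hg0 j (Finset.mem_range.1 hj) hjU, zero_mul]
  have hgB : ∀ j < n + 2, ‖g j‖ * Real.exp (j * t) ≤ (K : ℝ) ^ (2 * T.card + 1) * (2 * W * Γ) := by
    intro j hj
    have hΓ0 : 0 ≤ Γ := by positivity
    by_cases hjU : j ∈ U
    · refine norm_coeff_mul_exp_le (N := n + 1) (M := 2 * T.card + 2) (by omega) (by omega) U hUle
        hUc g t i ?_ hjU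
      intro s hs
      rw [hGU, norm_mul]
      refine mul_le_mul ?_ (hQ s hs) (norm_nonneg _) (by positivity)
      refine (norm_sub_le _ _).trans ?_
      rw [norm_one, norm_gridPoint]
      have := le_max_left 1 r
      have := le_max_right 1 r
      linarith
    · rw [hg0 j hj hjU]
      simp only [norm_zero, zero_mul]
      positivity
  have hμB : ∀ k : Fin (n + 1), ‖lam k‖ * Real.exp ((k : ℕ) * t)
      ≤ (n + 2) * ((K : ℝ) ^ (2 * T.card + 1) * (2 * Γ)) + 2 * τ := by
    intro k
    have h1 := norm_mul_exp_mul_max_le ν t (n + 1) hνN k.2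
    have h2 : ∑ j ∈ Finset.range (n + 1 + 1),
          ‖ν j - if j = 0 then 0 else ν (j - 1)‖ * Real.exp (j * t)
        ≤ (n + 2) * ((K : ℝ) ^ (2 * T.card + 1) * (2 * W * Γ)) := by
      calc _ ≤ ∑ _j ∈ Finset.range (n + 1 + 1), (K : ℝ) ^ (2 * T.card + 1) * (2 * W * Γ) :=
            Finset.sum_le_sum fun j hj => hgB j (Finset.mem_range.1 hj)
        _ = _ := by
            rw [Finset.sum_const, Finset.card_range, nsmul_eq_mul]
            push_cast
            ring
    have h3 : ν k = μ k := hνF₀ k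
    have h4 : (‖μ k‖ * Real.exp ((k : ℕ) * t)) * W
        ≤ ((n + 2) * ((K : ℝ) ^ (2 * T.card + 1) * (2 * Γ))) * W := by
      rw [← h3]
      calc _ ≤ _ := h1
        _ ≤ _ := h2
        _ = _ := by ring
    have h5 := le_of_mul_le_mul_right h4 (by linarith)
    have h6 : ‖lam k‖ ≤ ‖μ k‖ + ‖lam k - μ k‖ := by
      simpa using norm_add_le (μ k) (lam k - μ k)
    have h7 := hclose k
    calc ‖lam k‖ * Real.exp ((k : ℕ) * t)
        ≤ (‖μ k‖ + ‖lam k - μ k‖) * Real.exp ((k : ℕ) * t) := by gcongr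
      _ ≤ _ := by rw [add_mul]; linarith
  have hS : coeffSum lam t
      ≤ (n + 1) * ((n + 2) * ((K : ℝ) ^ (2 * T.card + 1) * (2 * Γ)) + 2 * τ) := by
    calc coeffSum lam t ≤ ∑ _k : Fin (n + 1),
          ((n + 2) * ((K : ℝ) ^ (2 * T.card + 1) * (2 * Γ)) + 2 * τ) :=
          Finset.sum_le_sum fun k _ => hμB k
      _ = _ := by simp [mul_add]
  have hΓK : Γ ≤ K * (B + τ) := by
    rw [hΓ]
    nlinarith
  set X := (K : ℝ) ^ (2 * T.card + 1) with hX
  have hX1 : 1 ≤ X := one_le_pow₀ hK1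
  have hpow : (K : ℝ) ^ (2 * T.card + 5) = X * K ^ 4 := by rw [hX, ← pow_add]
  rw [hpow]
  refine hS.trans ?_
  have e1 : (n + 2) * (X * (2 * Γ)) ≤ X * K ^ 2 * (B + τ) := by
    have : (n + 2) * (X * (2 * Γ)) = X * ((2 * (n + 2)) * Γ) := by ring
    rw [this]
    have : (2 * ((n : ℝ) + 2)) * Γ ≤ K * (K * (B + τ)) :=
      mul_le_mul hKn hΓK (by positivity) (by linarith)
    calc X * ((2 * (n + 2)) * Γ) ≤ X * (K * (K * (B + τ))) := by gcongr
      _ = _ := by ring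
  have e2 : 2 * τ ≤ X * K ^ 2 * (B + τ) := by
    have h2 : (2 : ℝ) ≤ K := by linarith
    have h3 : (2 : ℝ) ≤ X * K ^ 2 := by nlinarith
    calc 2 * τ ≤ X * K ^ 2 * τ := by gcongr
      _ ≤ _ := by gcongr; linarith
  have e3 : 2 * ((n : ℝ) + 1) ≤ K ^ 2 := by nlinarith
  calc ((n : ℝ) + 1) * ((n + 2) * (X * (2 * Γ)) + 2 * τ)
      ≤ (n + 1) * (X * K ^ 2 * (B + τ) + X * K ^ 2 * (B + τ)) := by gcongr
    _ = (2 * (n + 1)) * (X * K ^ 2 * (B + τ)) := by ring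
    _ ≤ K ^ 2 * (X * K ^ 2 * (B + τ)) := by gcongr
    _ = _ := by ring

/-! ### The good event -/

/-- `P` is not too small, compared with `coeffSum`, at one of the `2 m + 2` grid points following
the `i`-th one on the circle of radius `e^t`. With `m` of order `log n` and `K` of order `n²`, the
allowed loss is `exp (O (log² n))`. -/
def IsLargeNear {n : ℕ} (K m : ℕ) (lam : Fin (n + 1) → ℂ) (t : ℝ) (i : ℕ) : Prop :=
  ∃ s < 2 * m + 2,
    coeffSum lam t ≤ (K : ℝ) ^ (3 * m + 8) * ‖(poly lam).eval (gridPoint K t (i + s))‖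

/-- The abscissa at which the lines `log |λ_k| + k t` and `log |λ_l| + l t` cross. When one of the
coefficients vanishes, or when `k = l`, the value is meaningless but harmless: it only adds a
redundant condition to `IsGood`. -/
noncomputable def crossing {n : ℕ} (lam : Fin (n + 1) → ℂ) (k l : Fin (n + 1)) : ℝ :=
  (Real.log ‖lam k‖ - Real.log ‖lam l‖) / ((l : ℕ) - (k : ℕ) : ℝ)

/-- The good event: `P` is not too small near every grid point of every circle whose logarithmic
radius differs from a crossing by an offset in `O`. It is formulated with crossings in place of
vertices to make it a measurable condition with few possible radii. -/
def IsGood {n : ℕ} (K m : ℕ) (O : Finset ℝ) (lam : Fin (n + 1) → ℂ) : Prop :=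
  ∀ k l : Fin (n + 1), ∀ o ∈ O, ∀ i < K, IsLargeNear K m lam (crossing lam k l + o) i

theorem exists_top_finset {ι : Type*} [Fintype ι] [DecidableEq ι] (w : ι → ℝ) (m : ℕ)
    (hm : m ≤ Fintype.card ι) :
    ∃ T : Finset ι, T.card = m ∧ ∀ k ∈ T, ∀ l ∉ T, w l ≤ w k := by
  induction m with
  | zero => exact ⟨∅, by simp⟩
  | succ m ih =>
    obtain ⟨T, hT, hw⟩ := ih (by omega)
    have hne : (Finset.univ \ T).Nonempty := by
      rw [← Finset.card_pos, Finset.card_sdiff_of_subset (Finset.subset_univ T), Finset.card_univ]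
      omega
    obtain ⟨x, hx, hmax⟩ := Finset.exists_max_image _ w hne
    have hxT : x ∉ T := (Finset.mem_sdiff.1 hx).2
    refine ⟨insert x T, by rw [Finset.card_insert_of_notMem hxT, hT], ?_⟩
    intro k hk l hl
    rw [Finset.mem_insert, not_or] at hl
    rcases Finset.mem_insert.1 hk with rfl | hk
    · exact hmax l (by simp [hl.2])
    · exact hw k hk l hl.2

/-- At a fixed circle and grid point, `P_{λ^σ}` is small for at most a proportion `2^{-m}` of the
sign vectors `σ`. Let `T` be the set of the `m` largest `|λ'_k - λ''_k| e^{kt}`. Flipping inside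
`T` shows that `P_{λ^σ}` is rarely much smaller than the least of these numbers; and if that number
is negligible, then the coefficients off `T` are nearly constant. -/
theorem card_not_isLargeNear_mul_le {n : ℕ} (lam' lam'' : Fin (n + 1) → ℂ) (a : ℂ)
    (ha : ∀ k, (1 / 2 : ℝ) * (‖lam' k - a‖ + ‖lam'' k - a‖) ≤ ‖lam' k - lam'' k‖) {K m : ℕ}
    (hK : 2 * (n + 2) ≤ K) (hm1 : 1 ≤ m) (hm : m ≤ n + 1) (t : ℝ) (i : ℕ) :
    {σ : Fin (n + 1) → Bool | ¬ IsLargeNear K m (mix lam' lam'' σ) t i}.ncard * 2 ^ m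
      ≤ 2 ^ (n + 1) := by
  set w : Fin (n + 1) → ℝ := fun k => ‖lam' k - lam'' k‖ * Real.exp ((k : ℕ) * t) with hw
  obtain ⟨T, hTm, hT⟩ := exists_top_finset w m (by simpa using hm)
  have hTne : T.Nonempty := Finset.card_pos.1 (by omega)
  obtain ⟨x, hxT, hx⟩ := Finset.exists_min_image T w hTne
  have hτ0 : 0 ≤ w x := by simp only [hw]; positivity
  have hcount := card_flip_small_mul_le lam' lam'' (K := K) (by omega) t i T (w x) hx hTne
  rw [hTm] at hcount
  refine le_trans (Nat.mul_le_mul_right _ (Set.ncard_le_ncard ?_)) hcount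
  intro σ hσ
  by_contra hbad
  simp only [Set.mem_ofPred_eq, not_forall, not_lt] at hbad
  obtain ⟨s₀, hs₀, hP⟩ := hbad
  simp only [Set.mem_ofPred_eq, IsLargeNear, not_exists, not_and, not_le] at hσ
  set lam := mix lam' lam'' σ with hlam
  set S := coeffSum lam t with hS
  have hK4 : (4 : ℝ) ≤ K := by
    have : 4 ≤ K := by omega
    exact_mod_cast this
  have hK0 : (0 : ℝ) < K := by linarith
  have hS0 : 0 < S := lt_of_le_of_lt (by positivity) (hσ 0 (by omega))
  set κ := ((K : ℝ) ^ (3 * m + 8))⁻¹ with hκ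
  have hB : ∀ s < 2 * m + 2, ‖(poly lam).eval (gridPoint K t (i + s))‖ ≤ κ * S := by
    intro s hs
    rw [hκ, inv_mul_eq_div, le_div_iff₀ (by positivity), mul_comm]
    exact (hσ s hs).le
  have hnear : ∀ k ∉ T, ‖lam k - a‖ * Real.exp ((k : ℕ) * t) ≤ 2 * w x := by
    intro k hk
    have h1 := hT x hxT k hk
    have h2 : ‖lam k - a‖ ≤ 2 * ‖lam' k - lam'' k‖ := by
      have h3 := ha k
      have h4 : ‖lam k - a‖ ≤ ‖lam' k - a‖ + ‖lam'' k - a‖ := by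
        rw [hlam]
        unfold mix
        split_ifs
        · linarith [norm_nonneg (lam'' k - a)]
        · linarith [norm_nonneg (lam' k - a)]
      linarith
    calc ‖lam k - a‖ * Real.exp ((k : ℕ) * t)
        ≤ (2 * ‖lam' k - lam'' k‖) * Real.exp ((k : ℕ) * t) := by gcongr
      _ = 2 * w k := by simp only [hw]; ring
      _ ≤ 2 * w x := by linarith
  have hmain := coeffSum_le_of_near_constant lam a hK t i T hτ0 hnear (B := κ * S)
    (by rw [hTm]; exact hB)
  have hτ : w x ≤ 2 * (K : ℝ) ^ m * (κ * S) := by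
    have := hP.trans (hB s₀ (by omega))
    rwa [div_le_iff₀ (by positivity), mul_comm] at this
  rw [hTm] at hmain
  have hKm : (1 : ℝ) ≤ (K : ℝ) ^ m := one_le_pow₀ (by linarith)
  have hfin : S ≤ (K : ℝ) ^ (3 * m + 7) * (κ * S) := by
    have hκS : 0 ≤ κ * S := by positivity
    calc S ≤ (K : ℝ) ^ (2 * m + 5) * (κ * S + 2 * (K : ℝ) ^ m * (κ * S)) :=
          hmain.trans (by gcongr)
      _ = (K : ℝ) ^ (2 * m + 5) * ((1 + 2 * (K : ℝ) ^ m) * (κ * S)) := by ring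
      _ ≤ (K : ℝ) ^ (2 * m + 5) * (((K : ℝ) ^ m * (K : ℝ) ^ 2) * (κ * S)) := by
          gcongr
          have : (16 : ℝ) ≤ (K : ℝ) ^ 2 := by nlinarith
          nlinarith
      _ = (K : ℝ) ^ (3 * m + 7) * (κ * S) := by ring
  have hκK : (K : ℝ) ^ (3 * m + 7) * κ < 1 := by
    rw [hκ, ← div_eq_mul_inv, div_lt_one (by positivity)]
    exact pow_lt_pow_right₀ (by linarith) (by omega)
  nlinarith

/-- Union bound over crossings, offsets and grid points: for given `k` and `l` the crossing takes at
most four values as `σ` varies. -/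
theorem card_not_isGood_mul_le {n : ℕ} (lam' lam'' : Fin (n + 1) → ℂ) (a : ℂ)
    (ha : ∀ k, (1 / 2 : ℝ) * (‖lam' k - a‖ + ‖lam'' k - a‖) ≤ ‖lam' k - lam'' k‖) {K m : ℕ}
    (hK : 2 * (n + 2) ≤ K) (hm1 : 1 ≤ m) (hm : m ≤ n + 1) (O : Finset ℝ) :
    {σ : Fin (n + 1) → Bool | ¬ IsGood K m O (mix lam' lam'' σ)}.ncard * 2 ^ m
      ≤ 4 * (n + 1) ^ 2 * O.card * K * 2 ^ (n + 1) := by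
  classical
  set v : Bool → Fin (n + 1) → ℝ := fun e k => Real.log ‖if e then lam' k else lam'' k‖
  set X : Finset ((Fin (n + 1) × Fin (n + 1)) × (Bool × Bool) × ℝ × ℕ) :=
    Finset.univ ×ˢ Finset.univ ×ˢ O ×ˢ Finset.range K with hX
  set F : (Fin (n + 1) × Fin (n + 1)) × (Bool × Bool) × ℝ × ℕ → Finset (Fin (n + 1) → Bool) :=
    fun x => {σ | ¬ IsLargeNear K m (mix lam' lam'' σ)
      ((v x.2.1.1 x.1.1 - v x.2.1.2 x.1.2) / ((x.1.2 : ℕ) - (x.1.1 : ℕ) : ℝ) + x.2.2.1) x.2.2.2}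
    with hF
  have hsub : {σ : Fin (n + 1) → Bool | ¬ IsGood K m O (mix lam' lam'' σ)}
      ⊆ (X.biUnion F : Finset (Fin (n + 1) → Bool)) := by
    intro σ hσ
    simp only [Set.mem_ofPred_eq, IsGood, not_forall] at hσ
    obtain ⟨k, l, o, ho, i, hi, h⟩ := hσ
    rw [Finset.mem_coe, Finset.mem_biUnion]
    refine ⟨((k, l), (σ k, σ l), o, i), by simp [hX, ho, hi], ?_⟩
    simpa [hF, crossing, mix, v] using h
  have hFc : ∀ x, (F x).card * 2 ^ m ≤ 2 ^ (n + 1) := by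
    intro x
    have h := card_not_isLargeNear_mul_le lam' lam'' a ha hK hm1 hm
      ((v x.2.1.1 x.1.1 - v x.2.1.2 x.1.2) / ((x.1.2 : ℕ) - (x.1.1 : ℕ) : ℝ) + x.2.2.1) x.2.2.2
    rwa [Set.ncard_eq_toFinset_card', Set.toFinset_ofPred] at h
  have hXc : X.card = 4 * (n + 1) ^ 2 * O.card * K := by
    simp only [hX, Finset.card_product, Finset.card_univ, Fintype.card_prod, Fintype.card_fin,
      Fintype.card_bool, Finset.card_range]
    ring
  have h1 := Set.ncard_le_ncard hsub
  rw [Set.ncard_coe_finset] at h1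
  calc _ ≤ (∑ x ∈ X, (F x).card) * 2 ^ m :=
        Nat.mul_le_mul_right _ (h1.trans Finset.card_biUnion_le)
    _ = ∑ x ∈ X, (F x).card * 2 ^ m := Finset.sum_mul _ _ _
    _ ≤ ∑ _x ∈ X, 2 ^ (n + 1) := Finset.sum_le_sum fun x _ => hFc x
    _ = _ := by rw [Finset.sum_const, smul_eq_mul, hXc]

theorem measurable_coeffSum {n : ℕ} {f : (Fin (n + 1) → ℂ) → ℝ} (hf : Measurable f) :
    Measurable fun lam : Fin (n + 1) → ℂ => coeffSum lam (f lam) := by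
  unfold coeffSum
  fun_prop

theorem measurable_eval_gridPoint {n : ℕ} {f : (Fin (n + 1) → ℂ) → ℝ} (hf : Measurable f)
    (K j : ℕ) :
    Measurable fun lam : Fin (n + 1) → ℂ => (poly lam).eval (gridPoint K (f lam) j) := by
  simp only [eval_poly, gridPoint]
  fun_prop

theorem measurableSet_isGood {n : ℕ} (K m : ℕ) (O : Finset ℝ) :
    MeasurableSet {lam : Fin (n + 1) → ℂ | IsGood K m O lam} := by
  simp only [IsGood, IsLargeNear, Set.ofPred_forall, Set.ofPred_exists]
  refine MeasurableSet.iInter fun k => MeasurableSet.iInter fun l => ?_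
  refine MeasurableSet.biInter O.countable_toSet fun o _ => MeasurableSet.iInter fun i => ?_
  refine MeasurableSet.iInter fun _ => ?_
  have hf : Measurable fun lam : Fin (n + 1) → ℂ => crossing lam k l + o := by
    unfold crossing
    fun_prop
  have : ∀ s, MeasurableSet {lam : Fin (n + 1) → ℂ | coeffSum lam (crossing lam k l + o)
      ≤ (K : ℝ) ^ (3 * m + 8)
        * ‖(poly lam).eval (gridPoint K (crossing lam k l + o) (i + s))‖} := fun s =>
    measurableSet_le (measurable_coeffSum hf) (by
      have := measurable_eval_gridPoint hf K (i + s)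
      fun_prop)
  exact MeasurableSet.iUnion fun s => (MeasurableSet.const (s < 2 * m + 2)).inter (this s)

/-! ### The polygonal function and its vertices -/

/-- The `k`-th term strictly exceeds all the others on the circle of radius `e^t`. -/
def IsDominant {n : ℕ} (lam : Fin (n + 1) → ℂ) (k : Fin (n + 1)) (t : ℝ) : Prop :=
  ∀ l, l ≠ k → ‖lam l‖ * Real.exp ((l : ℕ) * t) < ‖lam k‖ * Real.exp ((k : ℕ) * t)

/-- The abscissas of the vertices of the polygonal function. -/
def vertexSet {n : ℕ} (lam : Fin (n + 1) → ℂ) : Set ℝ :=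
  {t : ℝ | ¬ DifferentiableAt ℝ (envelope lam) t}

section

variable {n : ℕ} {lam : Fin (n + 1) → ℂ}

theorem exp_log_add {k : Fin (n + 1)} (hk : lam k ≠ 0) (t : ℝ) :
    Real.exp (Real.log ‖lam k‖ + ((k : ℕ) : ℝ) * t) = ‖lam k‖ * Real.exp ((k : ℕ) * t) := by
  rw [Real.exp_add, Real.exp_log (norm_pos_iff.2 hk)]

theorem le_envelope {k : Fin (n + 1)} (hk : lam k ≠ 0) (t : ℝ) :
    Real.log ‖lam k‖ + ((k : ℕ) : ℝ) * t ≤ envelope lam t :=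
  le_ciSup (f := fun k : {k : Fin (n + 1) // lam k ≠ 0} =>
    Real.log ‖lam k‖ + ((k : Fin (n + 1)) : ℕ) * t) (Set.finite_range _).bddAbove ⟨k, hk⟩

theorem exists_eq_envelope (h0 : lam 0 ≠ 0) (t : ℝ) :
    ∃ k, lam k ≠ 0 ∧ Real.log ‖lam k‖ + ((k : ℕ) : ℝ) * t = envelope lam t := by
  have : Nonempty {k : Fin (n + 1) // lam k ≠ 0} := ⟨⟨0, h0⟩⟩
  obtain ⟨k, hk⟩ := exists_eq_ciSup_of_finite (f := fun k : {k : Fin (n + 1) // lam k ≠ 0} =>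
    Real.log ‖lam k‖ + ((k : Fin (n + 1)) : ℕ) * t)
  exact ⟨k, k.2, hk⟩

theorem isOpen_isDominant (k : Fin (n + 1)) : IsOpen {t | IsDominant lam k t} := by
  simp only [IsDominant, Set.ofPred_forall]
  refine isOpen_iInter_of_finite fun l => isOpen_iInter_of_finite fun _ => ?_
  exact isOpen_lt (by fun_prop) (by fun_prop)

theorem IsDominant.envelope_eq (h0 : lam 0 ≠ 0) {k : Fin (n + 1)} {t : ℝ}
    (h : IsDominant lam k t) :
    envelope lam t = Real.log ‖lam k‖ + ((k : ℕ) : ℝ) * t := by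
  obtain ⟨l, hl, hlt⟩ := exists_eq_envelope h0 t
  rcases eq_or_ne l k with rfl | hlk
  · exact hlt.symm
  · exfalso
    have h1 := h l hlk
    have hk : lam k ≠ 0 := by
      intro hk
      rw [hk, norm_zero, zero_mul] at h1
      exact absurd h1 (not_lt.2 (by positivity))
    rw [← exp_log_add hl, ← exp_log_add hk, Real.exp_lt_exp, hlt] at h1
    exact absurd h1 (not_lt.2 (le_envelope hk t))

/-- Near a point where one term dominates, the polygonal function is affine. -/
theorem IsDominant.notMem_vertexSet (h0 : lam 0 ≠ 0) {k : Fin (n + 1)} {t : ℝ}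
    (h : IsDominant lam k t) : t ∉ vertexSet lam := by
  have hev : (fun s => Real.log ‖lam k‖ + ((k : ℕ) : ℝ) * s) =ᶠ[nhds t] envelope lam := by
    filter_upwards [(isOpen_isDominant k).mem_nhds h] with s hs
    exact (IsDominant.envelope_eq h0 hs).symm
  have hd : DifferentiableAt ℝ (fun s => Real.log ‖lam k‖ + ((k : ℕ) : ℝ) * s) t := by fun_prop
  exact not_not.2 (hd.congr_of_eventuallyEq hev.symm)

/-- If two terms are maximal at `t`, the polygonal function lies above two lines of different slopes
and touches both, so it is not differentiable at `t`. -/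
theorem exists_isDominant (h0 : lam 0 ≠ 0) {t : ℝ} (ht : t ∉ vertexSet lam) :
    ∃ k, IsDominant lam k t := by
  obtain ⟨k, hk, hkt⟩ := exists_eq_envelope h0 t
  refine ⟨k, fun l hlk => ?_⟩
  have hkpos : 0 < ‖lam k‖ * Real.exp ((k : ℕ) * t) := by positivity
  by_cases hl : lam l = 0
  · simpa [hl] using hkpos
  rw [← exp_log_add hl, ← exp_log_add hk, Real.exp_lt_exp, hkt]
  refine lt_of_le_of_ne (le_envelope hl t) fun hlt => ht fun hd => hlk ?_
  have key : ∀ j : Fin (n + 1), lam j ≠ 0 →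
      Real.log ‖lam j‖ + ((j : ℕ) : ℝ) * t = envelope lam t →
      deriv (envelope lam) t = (j : ℕ) := by
    intro j hj hjt
    have hmin : IsLocalMin
        (fun s => envelope lam s - (Real.log ‖lam j‖ + ((j : ℕ) : ℝ) * s)) t := by
      refine Filter.Eventually.of_forall fun s => ?_
      have := le_envelope hj s
      simp only [← hjt]
      linarith
    have hd2 : HasDerivAt (fun s => Real.log ‖lam j‖ + ((j : ℕ) : ℝ) * s) ((j : ℕ) : ℝ) t := by
      simpa using ((hasDerivAt_id t).const_mul ((j : ℕ) : ℝ)).const_add (Real.log ‖lam j‖)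
    have h := hmin.hasDerivAt_eq_zero (hd.hasDerivAt.sub hd2)
    linarith
  have h1 := key l hl hlt
  rw [key k hk hkt] at h1
  exact Fin.ext (by exact_mod_cast h1.symm)

theorem exists_crossing_eq (h0 : lam 0 ≠ 0) {t : ℝ} (ht : t ∈ vertexSet lam) :
    ∃ k l, t = crossing lam k l := by
  obtain ⟨k, hk, hkt⟩ := exists_eq_envelope h0 t
  by_cases hdom : IsDominant lam k t
  · exact absurd ht (hdom.notMem_vertexSet h0)
  · simp only [IsDominant, not_forall, not_lt] at hdom
    obtain ⟨l, hlk, hle⟩ := hdom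
    have hl : lam l ≠ 0 := by
      intro hl
      rw [hl, norm_zero, zero_mul] at hle
      exact absurd hle (not_le.2 (by positivity))
    refine ⟨k, l, ?_⟩
    rw [← exp_log_add hl, ← exp_log_add hk, Real.exp_le_exp] at hle
    have h1 := le_envelope hl t
    have hne : ((l : ℕ) : ℝ) - (k : ℕ) ≠ 0 := by
      rw [sub_ne_zero]
      exact_mod_cast fun h => hlk (Fin.ext h)
    rw [crossing, eq_div_iff hne]
    linarith

theorem finite_vertexSet (h0 : lam 0 ≠ 0) : (vertexSet lam).Finite := by
  refine (Set.finite_range fun p : Fin (n + 1) × Fin (n + 1) => crossing lam p.1 p.2).subset ?_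
  intro t ht
  obtain ⟨k, l, rfl⟩ := exists_crossing_eq h0 ht
  exact ⟨(k, l), rfl⟩

/-- On an interval without vertices a single term dominates. -/
theorem exists_isDominant_on (h0 : lam 0 ≠ 0) {I : Set ℝ} (hI : IsPreconnected I)
    (hv : ∀ t ∈ I, t ∉ vertexSet lam) {t₀ : ℝ} (ht₀ : t₀ ∈ I) :
    ∃ k, ∀ t ∈ I, IsDominant lam k t := by
  obtain ⟨k, hk⟩ := exists_isDominant h0 (hv t₀ ht₀)
  refine ⟨k, hI.subset_of_closure_inter_subset (isOpen_isDominant k) ⟨t₀, ht₀, hk⟩ ?_⟩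
  rintro t ⟨htc, htI⟩
  have hcl : ∀ l, ‖lam l‖ * Real.exp ((l : ℕ) * t) ≤ ‖lam k‖ * Real.exp ((k : ℕ) * t) := by
    intro l
    have hclosed : IsClosed {s : ℝ | ‖lam l‖ * Real.exp ((l : ℕ) * s)
        ≤ ‖lam k‖ * Real.exp ((k : ℕ) * s)} := isClosed_le (by fun_prop) (by fun_prop)
    refine closure_minimal (fun s hs => ?_) hclosed htc
    rcases eq_or_ne l k with h | hlk
    · simp [h]
    · exact (hs l hlk).le
  obtain ⟨j, hj⟩ := exists_isDominant h0 (hv t htI)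
  rcases eq_or_ne j k with rfl | hjk
  · exact hj
  · exact absurd (hj k hjk.symm) (not_lt.2 (hcl j))

theorem sum_quarter_pow_le (N k : ℕ) (hk : k < N) :
    ∑ l ∈ Finset.range N, (if l = k then 0 else (1 / 4 : ℝ) ^ ((l - k) + (k - l))) < 1 := by
  have hlow : ∀ m ≤ k, ∑ l ∈ Finset.range m,
      (if l = k then 0 else (1 / 4 : ℝ) ^ ((l - k) + (k - l)))
      = (1 / 3) * (4 * (1 / 4) ^ (k + 1 - m) - 4 * (1 / 4) ^ (k + 1)) := by
    intro m
    induction m with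
    | zero => intro _; simp
    | succ m ih =>
      intro hm
      rw [Finset.sum_range_succ, ih (by omega), if_neg (by omega),
        show m - k + (k - m) = k - m by omega, show k + 1 - m = (k - m) + 1 by omega,
        show k + 1 - (m + 1) = k - m by omega]
      ring
  have hall : ∀ d, ∑ l ∈ Finset.range (k + 1 + d),
      (if l = k then 0 else (1 / 4 : ℝ) ^ ((l - k) + (k - l)))
      = (1 / 3) * (2 - 4 * (1 / 4) ^ (k + 1) - (1 / 4) ^ d) := by
    intro d
    induction d with
    | zero =>
      rw [add_zero, Finset.sum_range_succ, hlow k le_rfl, if_pos rfl,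
        show k + 1 - k = 1 by omega]
      ring
    | succ d ih =>
      rw [← add_assoc, Finset.sum_range_succ, ih, if_neg (by omega),
        show k + 1 + d - k + (k - (k + 1 + d)) = d + 1 by omega]
      ring
  obtain ⟨d, rfl⟩ : ∃ d, N = k + 1 + d := ⟨N - (k + 1), by omega⟩
  rw [hall]
  have h1 : (0 : ℝ) < (1 / 4) ^ (k + 1) := by positivity
  have h2 : (0 : ℝ) < (1 / 4) ^ d := by positivity
  linarith

/-- At logarithmic distance at least `2` from all the vertices, the dominant term exceeds the sum of
all the others, so `P` does not vanish. -/
theorem exists_vertex_near_root (h0 : lam 0 ≠ 0) {z : ℂ} (hz : (poly lam).eval z = 0) :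
    ∃ v ∈ vertexSet lam, |Real.log ‖z‖ - v| ≤ 2 := by
  by_contra! hfar
  have hz0 : z ≠ 0 := by
    rintro rfl
    exact h0 (by rwa [eval_zero_poly] at hz)
  set t := Real.log ‖z‖ with ht
  have hzt : ‖z‖ = Real.exp t := (Real.exp_log (norm_pos_iff.2 hz0)).symm
  obtain ⟨k, hk⟩ := exists_isDominant_on h0 (I := Set.Icc (t - 2) (t + 2)) isPreconnected_Icc
    (fun s hs hsv => by
      have := hfar s hsv
      rw [lt_abs] at this
      rcases this with h | h <;> linarith [hs.1, hs.2]) (t₀ := t) ⟨by linarith, by linarith⟩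
  set M := ‖lam k‖ * Real.exp ((k : ℕ) * t) with hM
  have hexp2 : Real.exp (-2) ≤ 1 / 4 := by
    have h1 : (2 : ℝ) ≤ Real.exp 1 := by
      have := Real.add_one_le_exp (1 : ℝ)
      linarith
    have h2 : (4 : ℝ) ≤ Real.exp 2 := by
      rw [show (2 : ℝ) = 1 + 1 by norm_num, Real.exp_add]
      nlinarith
    rw [Real.exp_neg, one_div]
    exact inv_anti₀ (by norm_num) h2
  have hterm : ∀ l, l ≠ k → ‖lam l‖ * Real.exp ((l : ℕ) * t)
      ≤ M * (1 / 4) ^ (((l : ℕ) - (k : ℕ)) + ((k : ℕ) - (l : ℕ))) := by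
    intro l hlk
    -- dominance at the end of the interval on the side of `l` gives the geometric decay at `t`
    have hside : ∀ s : ℝ, s ∈ Set.Icc (t - 2) (t + 2) →
        ‖lam l‖ * Real.exp ((l : ℕ) * t)
          ≤ M * Real.exp ((((k : ℕ) : ℝ) - (l : ℕ)) * (s - t)) := by
      intro s hs
      have h1 := (hk s hs l hlk).le
      have h2 : Real.exp ((l : ℕ) * t)
          = Real.exp ((l : ℕ) * s) * Real.exp (-((l : ℕ) * (s - t))) := by
        rw [← Real.exp_add]; congr 1; ring
      have h3 : M * Real.exp ((((k : ℕ) : ℝ) - (l : ℕ)) * (s - t))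
          = (‖lam k‖ * Real.exp ((k : ℕ) * s)) * Real.exp (-((l : ℕ) * (s - t))) := by
        rw [hM, mul_assoc, mul_assoc, ← Real.exp_add, ← Real.exp_add]; congr 2; ring
      rw [h2, h3, ← mul_assoc]
      gcongr
    have hM0 : 0 ≤ M := by positivity
    have hpow : ∀ d : ℕ, Real.exp (-(2 * (d : ℝ))) ≤ (1 / 4 : ℝ) ^ d := by
      intro d
      calc Real.exp (-(2 * (d : ℝ))) = Real.exp (-2) ^ d := by
            rw [← Real.exp_nat_mul]; congr 1; ring
        _ ≤ _ := by gcongr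
    rcases lt_or_gt_of_ne (fun h => hlk (Fin.ext h) : (l : ℕ) ≠ (k : ℕ)) with h | h
    · refine (hside (t - 2) ⟨le_rfl, by linarith⟩).trans ?_
      rw [show (l : ℕ) - (k : ℕ) + ((k : ℕ) - (l : ℕ)) = (k : ℕ) - (l : ℕ) by omega]
      refine mul_le_mul_of_nonneg_left ?_ hM0
      refine le_trans (le_of_eq ?_) (hpow _)
      rw [Nat.cast_sub h.le]; congr 1; ring
    · refine (hside (t + 2) ⟨by linarith, le_rfl⟩).trans ?_
      rw [show (l : ℕ) - (k : ℕ) + ((k : ℕ) - (l : ℕ)) = (l : ℕ) - (k : ℕ) by omega]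
      refine mul_le_mul_of_nonneg_left ?_ hM0
      refine le_trans (le_of_eq ?_) (hpow _)
      rw [Nat.cast_sub h.le]; congr 1; ring
  have hMpos : 0 < M := by
    have hkd := hk t ⟨by linarith, by linarith⟩
    rcases eq_or_ne (0 : Fin (n + 1)) k with h | h
    · rw [hM, ← h]; positivity
    · exact lt_of_le_of_lt (by positivity) (hkd 0 h)
  rw [eval_poly, ← Finset.add_sum_erase _ _ (Finset.mem_univ k)] at hz
  have h1 : M = ‖∑ l ∈ Finset.univ.erase k, lam l * z ^ (l : ℕ)‖ := by
    rw [← neg_eq_of_add_eq_zero_right hz, norm_neg, norm_mul, norm_pow, hzt,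
      ← Real.exp_nat_mul]
  have h2 : ‖∑ l ∈ Finset.univ.erase k, lam l * z ^ (l : ℕ)‖
      ≤ M * ∑ l ∈ Finset.range (n + 1),
        (if l = (k : ℕ) then 0 else (1 / 4 : ℝ) ^ ((l - (k : ℕ)) + ((k : ℕ) - l))) := by
    refine (norm_sum_le _ _).trans ?_
    rw [Finset.sum_range, ← Finset.add_sum_erase _ _ (Finset.mem_univ k), if_pos rfl, zero_add,
      Finset.mul_sum]
    refine Finset.sum_le_sum fun l hl => ?_
    have hlk : l ≠ k := Finset.ne_of_mem_erase hl
    rw [if_neg (fun h => hlk (Fin.ext h)), norm_mul, norm_pow, hzt, ← Real.exp_nat_mul]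
    exact hterm l hlk
  have h3 := sum_quarter_pow_le (n + 1) (k : ℕ) k.2
  nlinarith

end

/-! ### Counting zeros in a disc -/

theorem pow_card_le_prod_map {ι : Type*} (s : Multiset ι) (f : ι → ℝ) {b : ℝ} (hb : 0 ≤ b)
    (h : ∀ x ∈ s, b ≤ f x) : b ^ s.card ≤ (s.map f).prod := by
  induction s using Multiset.induction_on with
  | empty => simp
  | cons x s ih =>
    rw [Multiset.card_cons, Multiset.map_cons, Multiset.prod_cons, pow_succ']
    exact mul_le_mul (h x (Multiset.mem_cons_self x s))
      (ih fun y hy => h y (Multiset.mem_cons_of_mem hy)) (by positivity)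
      (hb.trans (h x (Multiset.mem_cons_self x s)))

theorem prod_map_le_pow_card {ι : Type*} (s : Multiset ι) (f : ι → ℝ) {b : ℝ}
    (h0 : ∀ x, 0 ≤ f x) (h : ∀ x ∈ s, f x ≤ b) : (s.map f).prod ≤ b ^ s.card := by
  induction s using Multiset.induction_on with
  | empty => simp
  | cons x s ih =>
    rw [Multiset.card_cons, Multiset.map_cons, Multiset.prod_cons, pow_succ']
    refine mul_le_mul (h x (Multiset.mem_cons_self x s))
      (ih fun y hy => h y (Multiset.mem_cons_of_mem hy)) ?_
      ((h0 x).trans (h x (Multiset.mem_cons_self x s)))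
    exact Multiset.prod_nonneg fun y hy => by
      obtain ⟨z, -, rfl⟩ := Multiset.mem_map.1 hy
      exact h0 z

theorem norm_eval_prod_X_sub_C (s : Multiset ℂ) (z : ℂ) :
    ‖((s.map fun x => Polynomial.X - Polynomial.C x).prod).eval z‖
      = (s.map fun x => ‖z - x‖).prod := by
  induction s using Multiset.induction_on with
  | empty => simp
  | cons x s ih => simp [ih]

open scoped Classical in
/-- A Jensen-type bound for the number of zeros of `P` in a disc, obtained from the maximum
principle for `P(z) / z^k` divided by the product of its zeros in the disc. Dividing by `z^k` allows
`P` to grow like its dominant term, which may vary by a large factor over the disc. -/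
theorem two_pow_card_roots_mul_le (P : Polynomial ℂ) (hP : P ≠ 0) (c : ℂ) {r R M : ℝ}
    (hc : ‖c‖ = r) (hr : 0 < r) (hR0 : 0 < R) (hR : R < 1) (k : ℕ)
    (hM : ∀ z, ‖z - c‖ = R * r → ‖P.eval z‖ ≤ M * (‖z‖ / r) ^ k) {w : ℂ} (hwr : ‖w‖ = r)
    (hw : ‖w - c‖ ≤ R * r / 8) :
    2 ^ (P.roots.filter fun z => ‖z - c‖ ≤ R * r / 8).card * ‖P.eval w‖ ≤ M := by
  set s := P.roots.filter fun z => ‖z - c‖ ≤ R * r / 8 with hs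
  set N := s.card with hN
  obtain ⟨Q, hQ⟩ := (Multiset.prod_X_sub_C_dvd_iff_le_roots hP s).2 (Multiset.filter_le _ _)
  have hRr : 0 < R * r := by positivity
  have hsmem : ∀ x ∈ s, ‖x - c‖ ≤ R * r / 8 := fun x hx => (Multiset.mem_filter.1 hx).2
  have heval : ∀ z, ‖P.eval z‖ = (s.map fun x => ‖z - x‖).prod * ‖Q.eval z‖ := by
    intro z
    rw [← norm_eval_prod_X_sub_C, ← norm_mul, ← Polynomial.eval_mul, ← hQ]
  have hne : ∀ z, ‖z - c‖ ≤ R * r → 0 < ‖z‖ := by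
    intro z hz
    have h1 : ‖c‖ ≤ ‖z‖ + ‖z - c‖ := by
      rw [norm_sub_rev]
      simpa using norm_add_le z (c - z)
    nlinarith
  set b := 7 * (R * r) / 8 with hb
  have hb0 : 0 < b := by positivity
  have hM0 : 0 ≤ M := by
    have h1 := hM (c + (R * r : ℝ)) (by simp [abs_of_pos hr, abs_of_pos hR0])
    have h2 := hne (c + (R * r : ℝ)) (by simp [abs_of_pos hr, abs_of_pos hR0])
    by_contra hneg
    have : M * (‖c + ((R * r : ℝ) : ℂ)‖ / r) ^ k < 0 :=
      mul_neg_of_neg_of_pos (not_le.1 hneg) (by positivity)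
    linarith [norm_nonneg (P.eval (c + ((R * r : ℝ) : ℂ)))]
  have hmax : ‖Q.eval w / w ^ k‖ ≤ M / r ^ k / b ^ N := by
    refine Complex.norm_le_of_forall_mem_frontier_norm_le (f := fun z => Q.eval z / z ^ k)
      (U := Metric.ball c (R * r)) Metric.isBounded_ball ?_ ?_ ?_
    · refine DifferentiableOn.diffContOnCl ?_
      rw [closure_ball c hRr.ne']
      intro z hz
      have hz' := hne z (by simpa [dist_eq_norm] using hz)
      exact (Q.differentiableAt.div (differentiableAt_pow k)
        (pow_ne_zero k (norm_pos_iff.1 hz'))).differentiableWithinAt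
    · rw [frontier_ball c hRr.ne']
      intro z hz
      have hz1 : ‖z - c‖ = R * r := by simpa [dist_eq_norm] using hz
      have hz0 := hne z hz1.le
      have h1 : b ^ N ≤ (s.map fun x => ‖z - x‖).prod := by
        refine pow_card_le_prod_map s _ hb0.le fun x hx => ?_
        have h2 : ‖z - c‖ ≤ ‖z - x‖ + ‖x - c‖ := norm_sub_le_norm_sub_add_norm_sub z x c
        have h3 := hsmem x hx
        rw [hz1] at h2
        rw [hb]
        linarith
      have h2 := hM z hz1
      rw [heval z, div_pow, mul_div_assoc'] at h2
      rw [norm_div, norm_pow, div_le_iff₀ (by positivity), div_div, div_mul_eq_mul_div,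
        le_div_iff₀ (by positivity)]
      rw [le_div_iff₀ (by positivity)] at h2
      calc ‖Q.eval z‖ * (r ^ k * b ^ N) = b ^ N * ‖Q.eval z‖ * r ^ k := by ring
        _ ≤ (s.map fun x => ‖z - x‖).prod * ‖Q.eval z‖ * r ^ k := by gcongr
        _ ≤ _ := h2
    · rw [closure_ball c hRr.ne', Metric.mem_closedBall, dist_eq_norm]
      linarith
  rw [norm_div, norm_pow, hwr, div_right_comm, div_le_div_iff_of_pos_right (by positivity),
    le_div_iff₀ (by positivity)] at hmax
  have hprod : (s.map fun x => ‖w - x‖).prod ≤ (b / 2) ^ N := by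
    refine prod_map_le_pow_card s _ (fun x => norm_nonneg _) fun x hx => ?_
    have h1 : ‖w - x‖ ≤ ‖w - c‖ + ‖c - x‖ := norm_sub_le_norm_sub_add_norm_sub w c x
    have h2 := hsmem x hx
    rw [norm_sub_rev] at h2
    rw [hb]
    linarith
  rw [heval w]
  calc 2 ^ N * ((s.map fun x => ‖w - x‖).prod * ‖Q.eval w‖)
      ≤ 2 ^ N * ((b / 2) ^ N * ‖Q.eval w‖) := by gcongr
    _ = ‖Q.eval w‖ * b ^ N := by rw [div_pow]; field_simp
    _ ≤ M := hmax

/-- `|P|` is at most `coeffSum` on each circle. -/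
theorem norm_eval_poly_le {n : ℕ} (lam : Fin (n + 1) → ℂ) {z : ℂ} (hz : z ≠ 0) :
    ‖(poly lam).eval z‖ ≤ coeffSum lam (Real.log ‖z‖) := by
  rw [eval_poly]
  refine (norm_sum_le _ _).trans (Finset.sum_le_sum fun k _ => ?_)
  rw [norm_mul, norm_pow, Real.exp_nat_mul, Real.exp_log (norm_pos_iff.2 hz)]

/-- The majorant `coeffSum` behaves like a monomial, up to the factor `n + 1`, on the annulus of
logarithmic half-width `δ` around the circle of radius `e^t`. -/
def IsMonomialLike {n : ℕ} (lam : Fin (n + 1) → ℂ) (t δ : ℝ) : Prop :=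
  ∃ k : ℕ, ∀ s, |s - t| ≤ δ →
    coeffSum lam s ≤ (n + 1) * coeffSum lam t * Real.exp (k * (s - t))

theorem isMonomialLike_of_forall_vertex {n : ℕ} {lam : Fin (n + 1) → ℂ} (h0 : lam 0 ≠ 0)
    {t δ : ℝ} (hδ : 0 ≤ δ) (h : ∀ v ∈ vertexSet lam, δ < |t - v|) : IsMonomialLike lam t δ := by
  obtain ⟨k, hk⟩ := exists_isDominant_on h0 (I := Set.Icc (t - δ) (t + δ)) isPreconnected_Icc
    (fun s hs hsv => by
      have := h s hsv
      rw [lt_abs] at this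
      rcases this with h | h <;> linarith [hs.1, hs.2]) (t₀ := t) ⟨by linarith, by linarith⟩
  refine ⟨k, fun s hs => ?_⟩
  rw [abs_le] at hs
  have h1 : coeffSum lam s ≤ (n + 1) * (‖lam k‖ * Real.exp ((k : ℕ) * s)) := by
    calc coeffSum lam s ≤ ∑ _l : Fin (n + 1), ‖lam k‖ * Real.exp ((k : ℕ) * s) := by
          refine Finset.sum_le_sum fun l _ => ?_
          rcases eq_or_ne l k with h | hlk
          · simp [h]
          · exact (hk s ⟨by linarith, by linarith⟩ l hlk).le
      _ = _ := by simp
  have h2 : ‖lam k‖ * Real.exp ((k : ℕ) * t) ≤ coeffSum lam t :=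
    Finset.single_le_sum (f := fun k : Fin (n + 1) => ‖lam k‖ * Real.exp ((k : ℕ) * t))
      (fun _ _ => by positivity) (Finset.mem_univ k)
  calc coeffSum lam s ≤ (n + 1) * (‖lam k‖ * Real.exp ((k : ℕ) * s)) := h1
    _ = (n + 1) * (‖lam k‖ * Real.exp ((k : ℕ) * t)) * Real.exp ((k : ℕ) * (s - t)) := by
        rw [mul_assoc, mul_assoc, ← Real.exp_add]; congr 3; ring
    _ ≤ _ := by gcongr

/-- At the scale `1 / n` the majorant `coeffSum` is nearly constant. -/
theorem isMonomialLike_of_le {n : ℕ} (hn : 1 ≤ n) (lam : Fin (n + 1) → ℂ) (t : ℝ) {δ : ℝ}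
    (hδ : δ ≤ 1 / (2 * n)) : IsMonomialLike lam t δ := by
  refine ⟨0, fun s hs => ?_⟩
  have hn' : (1 : ℝ) ≤ n := by exact_mod_cast hn
  have hexp : Real.exp (1 / 2) ≤ 2 := by
    have h1 := Real.exp_bound_div_one_sub_of_interval (x := 1 / 2) (by norm_num) (by norm_num)
    norm_num at h1 ⊢
    exact h1
  have h1 : coeffSum lam s ≤ 2 * coeffSum lam t := by
    unfold coeffSum
    rw [Finset.mul_sum]
    refine Finset.sum_le_sum fun k _ => ?_
    have hk : ((k : ℕ) : ℝ) ≤ n := by exact_mod_cast Nat.lt_succ_iff.1 k.2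
    have h2 : ((k : ℕ) : ℝ) * s ≤ 1 / 2 + (k : ℕ) * t := by
      have h3 : s - t ≤ 1 / (2 * n) := ((le_abs_self _).trans hs).trans hδ
      have h4 : ((k : ℕ) : ℝ) * (s - t) ≤ n * (1 / (2 * n)) := by
        have : (0 : ℝ) ≤ 1 / (2 * n) := by positivity
        calc ((k : ℕ) : ℝ) * (s - t) ≤ (k : ℕ) * (1 / (2 * n)) := by gcongr
          _ ≤ _ := by gcongr
      have h5 : (n : ℝ) * (1 / (2 * n)) = 1 / 2 := by field_simp
      linarith
    calc ‖lam k‖ * Real.exp ((k : ℕ) * s)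
        ≤ ‖lam k‖ * (Real.exp (1 / 2) * Real.exp ((k : ℕ) * t)) := by
          rw [← Real.exp_add]; gcongr
      _ ≤ ‖lam k‖ * (2 * Real.exp ((k : ℕ) * t)) := by gcongr
      _ = _ := by ring
  have h2 : 0 ≤ coeffSum lam t := Finset.sum_nonneg fun _ _ => by positivity
  simp only [CharP.cast_eq_zero, zero_mul, Real.exp_zero, mul_one]
  nlinarith

open scoped Classical in
/-- The zeros in a disc centred at a grid point of a circle near which `coeffSum` is monomial-like
are few, provided that `P` is not too small at one of the next grid points. -/
theorem two_pow_card_roots_le {n : ℕ} (lam : Fin (n + 1) → ℂ) (h0 : lam 0 ≠ 0) {K m i : ℕ}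
    {t ρ : ℝ} (hρ : 0 < ρ) (hρ1 : 64 * ρ ≤ 1) (hmono : IsMonomialLike lam t (64 * ρ))
    (hlarge : IsLargeNear K m lam t i) (hK : 2 * Real.pi * (2 * m + 2) ≤ 4 * ρ * K) (hK0 : 0 < K)
    (hnK : n + 1 ≤ K) :
    2 ^ ((poly lam).roots.filter
      fun z => ‖z - gridPoint K t i‖ ≤ 4 * ρ * Real.exp t).card ≤ K ^ (3 * m + 9) := by
  have hS : 0 < coeffSum lam t :=
    Finset.sum_pos' (fun _ _ => by positivity) ⟨0, Finset.mem_univ _, by positivity⟩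
  have hP : poly lam ≠ 0 := by
    intro h
    have h1 := eval_zero_poly lam
    rw [h] at h1
    exact h0 (by simpa using h1.symm)
  obtain ⟨k, hk⟩ := hmono
  obtain ⟨s, hs, hlow⟩ := hlarge
  have hKr : (0 : ℝ) < K := by exact_mod_cast hK0
  set c := gridPoint K t i with hc
  have hcn : ‖c‖ = Real.exp t := norm_gridPoint K t i
  have hr := Real.exp_pos t
  have hw : ‖gridPoint K t (i + s) - c‖ ≤ 32 * ρ * Real.exp t / 8 := by
    have h1 : gridPoint K t (i + s) - c = c *
        (Complex.exp (Complex.I * ((2 * Real.pi * s / K : ℝ) : ℂ)) - 1) := by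
      rw [mul_sub, mul_one]
      simp only [hc, gridPoint, ← Complex.exp_add]
      congr 2
      push_cast
      ring
    rw [h1, norm_mul, hcn]
    have h2 := Real.norm_exp_I_mul_ofReal_sub_one_le (x := 2 * Real.pi * s / K)
    have h3 : ‖2 * Real.pi * s / K‖ ≤ 4 * ρ := by
      rw [Real.norm_of_nonneg (by positivity), div_le_iff₀ hKr]
      refine le_trans ?_ hK
      have : (s : ℝ) ≤ 2 * m + 2 := by exact_mod_cast hs.le
      gcongr
    nlinarith
  have hbound : ∀ z, ‖z - c‖ = 32 * ρ * Real.exp t →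
      ‖(poly lam).eval z‖ ≤ ((n + 1) * coeffSum lam t) * (‖z‖ / Real.exp t) ^ k := by
    intro z hz
    have habs := abs_norm_sub_norm_le z c
    rw [hz, hcn, abs_le] at habs
    have hx1 : 1 - 32 * ρ ≤ ‖z‖ / Real.exp t := by
      rw [le_div_iff₀ hr]; linarith [habs.1]
    have hx2 : ‖z‖ / Real.exp t ≤ 1 + 32 * ρ := by
      rw [div_le_iff₀ hr]; linarith [habs.2]
    set x := ‖z‖ / Real.exp t with hx
    have hx0 : 0 < x := by linarith
    have hzn : 0 < ‖z‖ := by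
      have : ‖z‖ = x * Real.exp t := by rw [hx]; field_simp
      rw [this]; positivity
    have hlog : Real.log ‖z‖ - t = Real.log x := by
      rw [hx, Real.log_div hzn.ne' hr.ne', Real.log_exp]
    have hle : |Real.log ‖z‖ - t| ≤ 64 * ρ := by
      rw [hlog, abs_le]
      constructor
      · have h1 := Real.one_sub_inv_le_log_of_pos hx0
        have h2 : x⁻¹ ≤ 1 + 64 * ρ := by
          rw [inv_le_iff_one_le_mul₀ hx0]
          nlinarith
        linarith
      · have := Real.log_le_sub_one_of_pos hx0
        linarith
    refine (norm_eval_poly_le lam (norm_pos_iff.1 hzn)).trans ((hk _ hle).trans (le_of_eq ?_))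
    rw [hlog, Real.exp_nat_mul, Real.exp_log hx0]
  have hmain := two_pow_card_roots_mul_le (poly lam) hP c hcn hr (R := 32 * ρ) (by positivity)
    (by linarith) k hbound (norm_gridPoint K t (i + s)) hw
  rw [show 32 * ρ * Real.exp t / 8 = 4 * ρ * Real.exp t by ring] at hmain
  set N := ((poly lam).roots.filter fun z => ‖z - c‖ ≤ 4 * ρ * Real.exp t).card
  have h1 : (2 : ℝ) ^ N * coeffSum lam t ≤ (K : ℝ) ^ (3 * m + 9) * coeffSum lam t := by
    calc (2 : ℝ) ^ N * coeffSum lam t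
        ≤ 2 ^ N * ((K : ℝ) ^ (3 * m + 8) * ‖(poly lam).eval (gridPoint K t (i + s))‖) := by
          gcongr
      _ = (K : ℝ) ^ (3 * m + 8) * (2 ^ N * ‖(poly lam).eval (gridPoint K t (i + s))‖) := by ring
      _ ≤ (K : ℝ) ^ (3 * m + 8) * ((n + 1) * coeffSum lam t) := by gcongr
      _ ≤ (K : ℝ) ^ (3 * m + 8) * (K * coeffSum lam t) := by
          gcongr
          exact_mod_cast hnK
      _ = _ := by ring
  have h2 := le_of_mul_le_mul_right h1 hS
  exact_mod_cast h2

/-! ### Covering a Lipschitz curve by discs -/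

theorem card_le_card_mul_of_cover {α β : Type*} (s : Multiset α) (W : Finset β)
    (rel : α → β → Prop) [∀ w, DecidablePred fun z => rel z w] (D : ℕ)
    (hcov : ∀ z ∈ s, ∃ w ∈ W, rel z w)
    (hD : ∀ w ∈ W, (s.filter fun z => rel z w).card ≤ D) : s.card ≤ W.card * D := by
  have h : ∀ s' : Multiset α, (∀ z ∈ s', ∃ w ∈ W, rel z w) →
      s'.card ≤ ∑ w ∈ W, (s'.filter fun z => rel z w).card := by
    intro s'
    induction s' using Multiset.induction_on with
    | empty => simp
    | cons x s' ih =>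
      intro hc
      obtain ⟨w, hw, hx⟩ := hc x (Multiset.mem_cons_self x s')
      have h1 := ih fun z hz => hc z (Multiset.mem_cons_of_mem hz)
      rw [Multiset.card_cons]
      refine lt_of_le_of_lt h1 (Finset.sum_lt_sum (fun w _ => ?_) ⟨w, hw, ?_⟩)
      · exact Multiset.card_le_card (Multiset.filter_le_filter _ (Multiset.le_cons_self _ _))
      · rw [Multiset.filter_cons_of_pos (p := fun z => rel z w) _ hx, Multiset.card_cons]
        exact Nat.lt_succ_self _
  refine (h s hcov).trans ((Finset.sum_le_sum hD).trans (le_of_eq ?_))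
  rw [Finset.sum_const, smul_eq_mul]

/-- The offsets from a vertex at which circles are examined: `0` and `± 2 (127/128)^j` for
`j < J`. The ratio is so close to `1` that every point at distance at most `2` from the vertex is
much closer to one of these circles than the circle is to the vertex. -/
noncomputable def offsets (J : ℕ) : Finset ℝ :=
  insert 0 ((Finset.range J).image (fun j : ℕ => 2 * (127 / 128 : ℝ) ^ j) ∪
    (Finset.range J).image (fun j : ℕ => -(2 * (127 / 128 : ℝ) ^ j)))

theorem card_offsets_le (J : ℕ) : (offsets J).card ≤ 2 * J + 1 := by
  refine (Finset.card_insert_le _ _).trans ?_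
  have h1 := Finset.card_union_le
    ((Finset.range J).image (fun j : ℕ => 2 * (127 / 128 : ℝ) ^ j))
    ((Finset.range J).image (fun j : ℕ => -(2 * (127 / 128 : ℝ) ^ j)))
  have h2 := Finset.card_image_le (s := Finset.range J)
    (f := fun j : ℕ => 2 * (127 / 128 : ℝ) ^ j)
  have h3 := Finset.card_image_le (s := Finset.range J)
    (f := fun j : ℕ => -(2 * (127 / 128 : ℝ) ^ j))
  rw [Finset.card_range] at h2 h3
  omega

/-- The logarithmic half-width of the annulus around the circle at a given offset. -/
noncomputable def width (n : ℕ) (o : ℝ) : ℝ := if o = 0 then 1 / (128 * n) else |o| / 128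

/-- Every zero lies in one of the annuli around a vertex, at the centre of which `coeffSum` is
monomial-like at a larger scale. -/
theorem exists_annulus {n : ℕ} (hn : 1 ≤ n) {lam : Fin (n + 1) → ℂ} (h0 : lam 0 ≠ 0) {J : ℕ}
    (hJ : 2 * (127 / 128 : ℝ) ^ J ≤ 1 / (128 * n)) {z : ℂ} (hz : (poly lam).eval z = 0) :
    ∃ v ∈ vertexSet lam, ∃ o ∈ offsets J,
      |Real.log ‖z‖ - (v + o)| ≤ width n o ∧ 64 * width n o ≤ 1 ∧
      1 / (16384 * n) ≤ width n o ∧ IsMonomialLike lam (v + o) (64 * width n o) := by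
  have hn' : (1 : ℝ) ≤ n := by exact_mod_cast hn
  set t := Real.log ‖z‖ with ht
  obtain ⟨v₀, hv₀, hv₀t⟩ := exists_vertex_near_root h0 hz
  obtain ⟨v, hv, hmin⟩ := (vertexSet lam).exists_min_image (fun v => |t - v|)
    (finite_vertexSet h0) ⟨v₀, hv₀⟩
  have hd2 : |t - v| ≤ 2 := (hmin v₀ hv₀).trans hv₀t
  refine ⟨v, hv, ?_⟩
  rcases le_or_gt |t - v| (1 / (128 * n)) with hd | hd
  · have hw : width n 0 = 1 / (128 * n) := if_pos rfl
    refine ⟨0, Finset.mem_insert_self _ _, ?_⟩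
    rw [hw]
    refine ⟨by simpa using hd, ?_, ?_, ?_⟩
    · rw [mul_one_div, div_le_one (by positivity)]; linarith
    · gcongr; norm_num
    · refine isMonomialLike_of_le hn lam _ (le_of_eq ?_)
      field_simp
      norm_num
  · have hdpos : 0 < |t - v| := lt_trans (by positivity) hd
    obtain ⟨j, hj1, hj2⟩ := exists_nat_pow_near_of_lt_one (x := |t - v| / 2) (y := (127 / 128 : ℝ))
      (by positivity) (by linarith) (by norm_num) (by norm_num)
    have hjJ : j < J := by
      by_contra h
      have : (127 / 128 : ℝ) ^ j ≤ (127 / 128 : ℝ) ^ J :=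
        pow_le_pow_of_le_one (by norm_num) (by norm_num) (not_lt.1 h)
      linarith
    set p := (127 / 128 : ℝ) ^ j with hp
    have hp0 : 0 < p := by positivity
    rw [pow_succ, ← hp] at hj1
    obtain ⟨o, ho, hoabs, hto⟩ : ∃ o ∈ offsets J, |o| = 2 * p ∧
        |t - (v + o)| = 2 * p - |t - v| := by
      rcases le_total v t with h | h
      · refine ⟨2 * p, ?_, abs_of_pos (by positivity), ?_⟩
        · refine Finset.mem_insert_of_mem (Finset.mem_union_left _ ?_)
          exact Finset.mem_image.2 ⟨j, Finset.mem_range.2 hjJ, rfl⟩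
        · have hab : |t - v| = t - v := abs_of_nonneg (by linarith)
          rw [hab] at hj2 ⊢
          rw [abs_of_nonpos (by linarith)]
          ring
      · refine ⟨-(2 * p), ?_, by rw [abs_neg, abs_of_pos (by positivity)], ?_⟩
        · refine Finset.mem_insert_of_mem (Finset.mem_union_right _ ?_)
          exact Finset.mem_image.2 ⟨j, Finset.mem_range.2 hjJ, rfl⟩
        · have hab : |t - v| = -(t - v) := abs_of_nonpos (by linarith)
          rw [hab] at hj2 ⊢
          rw [abs_of_nonneg (by linarith)]
          ring
    have ho0 : o ≠ 0 := by
      rintro rfl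
      rw [abs_zero] at hoabs
      linarith
    have hw : width n o = p / 64 := by
      rw [width, if_neg ho0, hoabs]; ring
    have hp1 : p ≤ 1 := pow_le_one₀ (by norm_num) (by norm_num)
    refine ⟨o, ho, ?_⟩
    rw [hw, hto]
    refine ⟨by linarith, by linarith, ?_, ?_⟩
    · have : 1 / (16384 * (n : ℝ)) = 1 / (128 * n) / 128 := by field_simp; norm_num
      rw [this]
      linarith
    · refine isMonomialLike_of_forall_vertex h0 (by positivity) fun v' hv' => ?_
      have h1 := hmin v' hv'
      have h2 : |t - v'| ≤ |t - (v + o)| + |v + o - v'| := abs_sub_le _ _ _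
      linarith

/-- Every angle is close to a grid angle, modulo `2π`. -/
theorem exists_grid_angle {K : ℕ} (hK : 0 < K) (α : ℝ) :
    ∃ j < K, ∃ p : ℤ, |α - p * (2 * Real.pi) - 2 * Real.pi * j / K| ≤ 2 * Real.pi / K := by
  have hK' : (0 : ℝ) < K := by exact_mod_cast hK
  have hKz : (0 : ℤ) < K := by exact_mod_cast hK
  have hπ := Real.pi_pos
  set x := α * K / (2 * Real.pi) with hx
  set N := ⌊x⌋ with hN
  have hmod := Int.emod_nonneg N hKz.ne'
  have hmodlt := Int.emod_lt_of_pos N hKz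
  refine ⟨(N % K).toNat, by omega, N / K, ?_⟩
  have hcast : (((N % K).toNat : ℕ) : ℝ) = ((N % K : ℤ) : ℝ) := by
    exact_mod_cast congrArg (Int.cast (R := ℝ)) (Int.toNat_of_nonneg hmod)
  have hdiv : ((N % K : ℤ) : ℝ) + K * ((N / K : ℤ) : ℝ) = (N : ℝ) := by
    exact_mod_cast congrArg (Int.cast (R := ℝ)) (Int.emod_add_mul_ediv N K)
  have hα : α = 2 * Real.pi / K * x := by rw [hx]; field_simp
  have heq : α - ((N / K : ℤ) : ℝ) * (2 * Real.pi) - 2 * Real.pi * (((N % K).toNat : ℕ) : ℝ) / K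
      = 2 * Real.pi / K * (x - N) := by
    rw [hcast, ← hdiv]
    nth_rewrite 1 [hα]
    field_simp
    ring
  rw [heq, abs_mul, abs_of_pos (by positivity)]
  have h1 : |x - N| ≤ 1 := by
    rw [abs_le]
    constructor <;> linarith [Int.floor_le x, Int.lt_floor_add_one x]
  nlinarith [show 0 < 2 * Real.pi / K by positivity]

theorem norm_sub_gridPoint_le {K j : ℕ} {t s φ ρ : ℝ} {p : ℤ} (hρ : 64 * ρ ≤ 1)
    (hs : |s - t| ≤ ρ) (hφ : |φ - p * (2 * Real.pi) - 2 * Real.pi * j / K| ≤ ρ) :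
    ‖((Real.exp s : ℝ) : ℂ) * Complex.exp ((φ : ℂ) * Complex.I) - gridPoint K t j‖
      ≤ 4 * ρ * Real.exp t := by
  set ψ := φ - p * (2 * Real.pi) - 2 * Real.pi * j / K with hψ
  have h1 : ((Real.exp s : ℝ) : ℂ) * Complex.exp ((φ : ℂ) * Complex.I) - gridPoint K t j
      = gridPoint K t j * (Complex.exp (((s - t : ℝ) : ℂ) + (ψ : ℂ) * Complex.I) - 1) := by
    rw [mul_sub, mul_one]
    congr 1
    rw [gridPoint, ← Complex.exp_add, Complex.ofReal_exp, ← Complex.exp_add,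
      Complex.exp_eq_exp_iff_exists_int]
    refine ⟨p, ?_⟩
    rw [hψ]
    push_cast
    ring
  have h2 : ‖((s - t : ℝ) : ℂ) + (ψ : ℂ) * Complex.I‖ ≤ 2 * ρ := by
    refine (norm_add_le _ _).trans ?_
    rw [norm_mul, Complex.norm_I, mul_one, Complex.norm_real, Complex.norm_real,
      Real.norm_eq_abs, Real.norm_eq_abs]
    linarith
  have hρ0 : 0 ≤ ρ := (abs_nonneg _).trans hs
  have h3 := Complex.norm_exp_sub_one_le (h2.trans (by linarith))
  rw [h1, norm_mul, norm_gridPoint]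
  nlinarith [Real.exp_pos t]

theorem abs_round_le {x L : ℝ} (hx : |x| ≤ L) : |round x| ≤ (⌈L⌉₊ : ℤ) := by
  have hL := Nat.le_ceil L
  rw [abs_le] at hx ⊢
  have h1 := round_le_add_half x
  have h2 := sub_half_lt_round x
  constructor
  · have : (-(⌈L⌉₊ : ℤ) - 1 : ℤ) < round x := by
      have : ((-(⌈L⌉₊ : ℤ) - 1 : ℤ) : ℝ) < round x := by push_cast; linarith
      exact_mod_cast this
    omega
  · have : round x < (⌈L⌉₊ : ℤ) + 1 := by
      have : ((round x : ℤ) : ℝ) < (((⌈L⌉₊ : ℤ) + 1 : ℤ) : ℝ) := by push_cast; linarith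
      exact_mod_cast this
    omega

/-- On the good event, the zeros on a Lipschitz curve are bounded by the number of discs that cover
the part of the curve near the vertices, times the number of zeros in each disc. -/
theorem numZerosOn_le_of_isGood {n : ℕ} (hn : 1 ≤ n) {lam : Fin (n + 1) → ℂ} (h0 : lam 0 ≠ 0)
    {L : ℝ} {Γ : Set ℂ} (hL : 0 ≤ L) (hΓ : IsLipschitzCurve L Γ) {K m J e : ℕ} (hm : 1 ≤ m)
    (hgood : IsGood K m (offsets J) lam) (hJ : 2 * (127 / 128 : ℝ) ^ J ≤ 1 / (128 * n))
    (hK : 2 * Real.pi * (2 * m + 2) * (8192 * n) ≤ K) (hKe : K ≤ 2 ^ e) :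
    numZerosOn Γ (poly lam)
      ≤ numVertices lam * (2 * J + 1) * (2 * ⌈L⌉₊ + 1) * (e * (3 * m + 9)) := by
  classical
  obtain ⟨θ, hθ, rfl⟩ := hΓ
  have hn' : (1 : ℝ) ≤ n := by exact_mod_cast hn
  have hm' : (1 : ℝ) ≤ m := by exact_mod_cast hm
  have hπ := Real.pi_gt_three
  have hKbig : 8192 * (n : ℝ) ≤ K := by
    refine le_trans ?_ hK
    have h1 : (1 : ℝ) ≤ 2 * Real.pi * (2 * m + 2) := by nlinarith
    nlinarith
  have hKr : (0 : ℝ) < K := by linarith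
  have hK0 : 0 < K := by exact_mod_cast hKr
  have hnK : n + 1 ≤ K := by
    have : (n : ℝ) + 1 ≤ K := by linarith
    exact_mod_cast this
  set Γ := {z : ℂ | ∃ r : ℝ, 0 ≤ r ∧ z = (r : ℂ) * Complex.exp ((θ r : ℂ) * Complex.I)} with hΓ
  have hfin := finite_vertexSet h0
  set Z := (poly lam).roots.filter fun z => z ∈ Γ with hZ
  set W : Finset (ℝ × ℝ × ℤ) :=
    hfin.toFinset ×ˢ offsets J ×ˢ Finset.Icc (-(⌈L⌉₊ : ℤ)) ⌈L⌉₊ with hW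
  set rel : ℂ → ℝ × ℝ × ℤ → Prop := fun z w =>
    (64 * width n w.2.1 ≤ 1 ∧ 1 / (16384 * n) ≤ width n w.2.1 ∧
      IsMonomialLike lam (w.1 + w.2.1) (64 * width n w.2.1)) ∧
    |Real.log ‖z‖ - (w.1 + w.2.1)| ≤ width n w.2.1 ∧
    |θ ‖z‖ - (θ (Real.exp (w.1 + w.2.1)) + w.2.2 * width n w.2.1)| ≤ width n w.2.1 / 2 with hrel
  have hnorm : ∀ z ∈ Γ, z = (‖z‖ : ℂ) * Complex.exp ((θ ‖z‖ : ℂ) * Complex.I) := by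
    rintro z ⟨r, hr, rfl⟩
    have : ‖(r : ℂ) * Complex.exp ((θ r : ℂ) * Complex.I)‖ = r := by
      rw [norm_mul, Complex.norm_exp_ofReal_mul_I, mul_one, Complex.norm_real,
        Real.norm_of_nonneg hr]
    rw [this]
  have hev : ∀ z ∈ Z, (poly lam).eval z = 0 := fun z hz =>
    (Polynomial.mem_roots'.1 (Multiset.mem_filter.1 hz).1).2
  have hne : ∀ z ∈ Z, 0 < ‖z‖ := by
    intro z hz
    rw [norm_pos_iff]
    rintro rfl
    exact h0 (by simpa only [eval_zero_poly] using hev 0 hz)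
  have hcov : ∀ z ∈ Z, ∃ w ∈ W, rel z w := by
    intro z hz
    obtain ⟨v, hv, o, ho, hclose, h1, h2, h3⟩ := exists_annulus hn h0 hJ (hev z hz)
    have hρ : 0 < width n o := lt_of_lt_of_le (by positivity) h2
    set x := (θ ‖z‖ - θ (Real.exp (v + o))) / width n o with hx
    have hxL : |x| ≤ L := by
      rw [hx, abs_div, abs_of_pos hρ, div_le_iff₀ hρ]
      refine (hθ _ _ (hne z hz) (Real.exp_pos _)).trans ?_
      rw [Real.log_div (hne z hz).ne' (Real.exp_pos _).ne', Real.log_exp]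
      gcongr
    refine ⟨(v, o, round x), ?_, ⟨h1, h2, h3⟩, hclose, ?_⟩
    · simp only [hW, Finset.mem_product, Set.Finite.mem_toFinset, Finset.mem_Icc]
      exact ⟨hv, ho, abs_le.1 (abs_round_le hxL)⟩
    · have h4 := abs_sub_round x
      have h5 : θ ‖z‖ - (θ (Real.exp (v + o)) + (round x : ℝ) * width n o)
          = (x - round x) * width n o := by
        rw [hx]; field_simp; ring
      simp only
      rw [h5, abs_mul, abs_of_pos hρ]
      nlinarith
  have hD : ∀ w ∈ W, (Z.filter fun z => rel z w).card ≤ e * (3 * m + 9) := by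
    rintro ⟨v, o, i⟩ hw
    simp only [hW, Finset.mem_product, Set.Finite.mem_toFinset, Finset.mem_Icc] at hw
    obtain ⟨hv, ho, -⟩ := hw
    by_cases hreg : 64 * width n o ≤ 1 ∧ 1 / (16384 * n) ≤ width n o ∧
        IsMonomialLike lam (v + o) (64 * width n o)
    swap
    · rw [Multiset.filter_eq_nil.2 fun z _ h => hreg h.1]
      simp
    obtain ⟨h1, h2, h3⟩ := hreg
    set ρ := width n o with hρdef
    have hρ : 0 < ρ := lt_of_lt_of_le (by positivity) h2
    obtain ⟨j, hj, p, hp⟩ := exists_grid_angle hK0 (θ (Real.exp (v + o)) + i * ρ)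
    have hρn : 1 ≤ ρ * (16384 * n) := by rwa [div_le_iff₀ (by positivity)] at h2
    have hKρ : 2 * Real.pi * (2 * m + 2) ≤ 2 * ρ * K := by
      have h4 : 2 * Real.pi * (2 * m + 2) ≤ K / (8192 * n) := by
        rwa [le_div_iff₀ (by positivity)]
      refine h4.trans ?_
      rw [div_le_iff₀ (by positivity)]
      nlinarith
    have hstep : 2 * Real.pi / K ≤ ρ / 2 := by
      rw [div_le_iff₀ hKr]
      nlinarith
    obtain ⟨k, l, hkl⟩ := exists_crossing_eq h0 hv
    have hlarge : IsLargeNear K m lam (v + o) j := by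
      rw [hkl]
      exact hgood k l o ho j hj
    have hcount := two_pow_card_roots_le lam h0 hρ h1 h3 hlarge (by nlinarith) hK0 hnK
    have hsub : (Z.filter fun z => rel z (v, o, i)) ≤ (poly lam).roots.filter
        fun z => ‖z - gridPoint K (v + o) j‖ ≤ 4 * ρ * Real.exp (v + o) := by
      rw [Multiset.le_filter]
      refine ⟨(Multiset.filter_le _ _).trans (Multiset.filter_le _ _), fun z hz => ?_⟩
      obtain ⟨hzZ, -, hz1, hz2⟩ := Multiset.mem_filter.1 hz
      simp only at hz1 hz2
      have hzpos := hne z hzZ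
      rw [hnorm z (Multiset.mem_filter.1 hzZ).2]
      have := norm_sub_gridPoint_le (K := K) (j := j) (p := p) (φ := θ ‖z‖) h1 hz1 (by
        have h4 : θ ‖z‖ - p * (2 * Real.pi) - 2 * Real.pi * j / K
            = (θ ‖z‖ - (θ (Real.exp (v + o)) + i * ρ))
              + (θ (Real.exp (v + o)) + i * ρ - p * (2 * Real.pi) - 2 * Real.pi * j / K) := by
          ring
        rw [h4]
        refine (abs_add_le _ _).trans ?_
        linarith)
      rwa [Real.exp_log hzpos] at this
    have h5 : 2 ^ (Z.filter fun z => rel z (v, o, i)).card ≤ 2 ^ (e * (3 * m + 9)) := by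
      calc 2 ^ (Z.filter fun z => rel z (v, o, i)).card
          ≤ _ := Nat.pow_le_pow_right (by norm_num) (Multiset.card_le_card hsub)
        _ ≤ K ^ (3 * m + 9) := hcount
        _ ≤ (2 ^ e) ^ (3 * m + 9) := Nat.pow_le_pow_left hKe _
        _ = _ := (pow_mul _ _ _).symm
    exact (Nat.pow_le_pow_iff_right (by norm_num)).1 h5
  have hmain := card_le_card_mul_of_cover Z W rel (e * (3 * m + 9)) hcov hD
  have hZc : numZerosOn Γ (poly lam) = Z.card := by
    unfold numZerosOn
    rw [hZ]
  have hWc : W.card ≤ numVertices lam * (2 * J + 1) * (2 * ⌈L⌉₊ + 1) := by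
    have e1 : hfin.toFinset.card = numVertices lam := (Set.ncard_eq_toFinset_card _ hfin).symm
    have e2 : (Finset.Icc (-(⌈L⌉₊ : ℤ)) ⌈L⌉₊).card = 2 * ⌈L⌉₊ + 1 := by
      rw [Int.card_Icc]; omega
    rw [hW, Finset.card_product, Finset.card_product, e1, e2, ← mul_assoc]
    gcongr
    exact card_offsets_le J
  rw [hZc]
  exact hmain.trans (Nat.mul_le_mul_right _ hWc)

/-! ### Probability of the good event -/

/-- By flip-invariance, the probability of the bad event is the expectation of the proportion of
bad sign vectors `σ`, which is bounded pointwise. -/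
theorem measure_not_isGood_mul_le {Ω : Type*} [MeasurableSpace Ω] {n : ℕ} {μ : Measure Ω}
    {lam : Ω → Fin (n + 1) → ℂ} (h : PropertyTheta μ lam) {K m : ℕ} (hK : 2 * (n + 2) ≤ K)
    (hm1 : 1 ≤ m) (hm : m ≤ n + 1) (O : Finset ℝ) :
    μ {ω | ¬ IsGood K m O (lam ω)} * 2 ^ m ≤ ((4 * (n + 1) ^ 2 * O.card * K : ℕ) : ENNReal) := by
  classical
  obtain ⟨Ω', _, ρ, _, lam', lam'', h', -, hflip, a, ha⟩ := h
  set G : Set (Fin (n + 1) → ℂ) := {x | ¬ IsGood K m O x} with hG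
  have hGm : MeasurableSet G := (measurableSet_isGood K m O).compl
  have heq : ∀ σ, ρ (flip lam' lam'' σ ⁻¹' G) = μ {ω | ¬ IsGood K m O (lam ω)} := by
    intro σ
    have h1 := (hflip σ fun _ => true).measure_mem_eq hGm
    have h2 : flip lam' lam'' (fun _ => true) = lam' := by
      funext ω k
      simp [flip]
    rw [h2] at h1
    exact h1.trans (h'.measure_mem_eq hGm)
  have hnull : ∀ σ, NullMeasurableSet (flip lam' lam'' σ ⁻¹' G) ρ := fun σ =>
    (hflip σ σ).aemeasurable_fst.nullMeasurable hGm
  have hsum : ∑ σ : Fin (n + 1) → Bool, ρ (flip lam' lam'' σ ⁻¹' G)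
      = ∫⁻ ω, ∑ σ : Fin (n + 1) → Bool,
          (flip lam' lam'' σ ⁻¹' G).indicator (1 : Ω' → ENNReal) ω ∂ρ := by
    refine Eq.trans ?_ (lintegral_finsetSum' (f := fun σ : Fin (n + 1) → Bool =>
      (flip lam' lam'' σ ⁻¹' G).indicator (1 : Ω' → ENNReal)) _
      fun σ _ => aemeasurable_one.indicator₀ (hnull σ)).symm
    exact Finset.sum_congr rfl fun σ _ => (lintegral_indicator_one₀ (hnull σ)).symm
  have hpt : ∀ᵐ ω ∂ρ, (∑ σ : Fin (n + 1) → Bool,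
      (flip lam' lam'' σ ⁻¹' G).indicator (1 : Ω' → ENNReal) ω) * 2 ^ m
        ≤ ((4 * (n + 1) ^ 2 * O.card * K * 2 ^ (n + 1) : ℕ) : ENNReal) := by
    filter_upwards [ae_all_iff.2 ha] with ω hω
    have h1 := card_not_isGood_mul_le (lam' ω) (lam'' ω) a hω hK hm1 hm O
    have h2 : ∑ σ : Fin (n + 1) → Bool, (flip lam' lam'' σ ⁻¹' G).indicator (1 : Ω' → ENNReal) ω
        = (({σ : Fin (n + 1) → Bool |
            ¬ IsGood K m O (mix (lam' ω) (lam'' ω) σ)}.ncard : ℕ) : ENNReal) := by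
      rw [Set.ncard_eq_toFinset_card', Set.toFinset_ofPred, Finset.card_filter]
      push_cast
      refine Finset.sum_congr rfl fun σ _ => ?_
      rw [Set.indicator_apply]
      exact if_congr Iff.rfl rfl rfl
    rw [h2]
    exact_mod_cast h1
  have hint : (∫⁻ ω, ∑ σ : Fin (n + 1) → Bool,
      (flip lam' lam'' σ ⁻¹' G).indicator (1 : Ω' → ENNReal) ω ∂ρ) * 2 ^ m
        ≤ ((4 * (n + 1) ^ 2 * O.card * K * 2 ^ (n + 1) : ℕ) : ENNReal) := by
    rw [← lintegral_mul_const' _ _ (by finiteness)]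
    refine (lintegral_mono_ae hpt).trans ?_
    simp
  rw [← hsum, Finset.sum_congr rfl fun σ _ => heq σ, Finset.sum_const, Finset.card_univ,
    Fintype.card_fun, Fintype.card_bool, Fintype.card_fin, nsmul_eq_mul] at hint
  have h2 : ((2 ^ (n + 1) : ℕ) : ENNReal) ≠ 0 := by positivity
  refine (ENNReal.mul_le_mul_iff_right h2 (ENNReal.natCast_ne_top _)).1 ?_
  calc _ = ((2 ^ (n + 1) : ℕ) : ENNReal) * μ {ω | ¬ IsGood K m O (lam ω)} * 2 ^ m := by
        rw [mul_assoc]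
    _ ≤ _ := hint
    _ = _ := by push_cast; ring

/-! ### Choice of parameters -/

/-- The number of zeros is at most the degree, and it is zero if there are no vertices. -/
theorem numZerosOn_le_numVertices_mul {n : ℕ} {lam : Fin (n + 1) → ℂ} (h0 : lam 0 ≠ 0)
    (Γ : Set ℂ) : numZerosOn Γ (poly lam) ≤ numVertices lam * n := by
  classical
  rcases (numZerosOn Γ (poly lam)).eq_zero_or_pos with h | h
  · rw [h]; exact Nat.zero_le _
  obtain ⟨z, hz⟩ := Multiset.card_pos_iff_exists_mem.1 h
  obtain ⟨v, hv, -⟩ := exists_vertex_near_root h0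
    (Polynomial.mem_roots'.1 (Multiset.mem_filter.1 hz).1).2
  have hV : 1 ≤ numVertices lam := (Set.ncard_pos (finite_vertexSet h0)).2 ⟨v, hv⟩
  have hdeg : (poly lam).natDegree ≤ n :=
    Polynomial.natDegree_sum_le_of_forall_le _ _ fun k _ =>
      (Polynomial.natDegree_C_mul_X_pow_le _ _).trans (Nat.lt_succ_iff.1 k.2)
  have h1 : numZerosOn Γ (poly lam) ≤ n :=
    (Multiset.card_le_card (Multiset.filter_le _ _)).trans
      ((Polynomial.card_roots' _).trans hdeg)
  exact h1.trans (Nat.le_mul_of_pos_left n hV)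

theorem two_mul_pow_le {n : ℕ} (hn : 1 ≤ n) :
    2 * (127 / 128 : ℝ) ^ (128 * (Nat.log 2 n + 1 + 8)) ≤ 1 / (128 * n) := by
  have hn' : (1 : ℝ) ≤ n := by exact_mod_cast hn
  have h1 : (127 / 128 : ℝ) ^ 128 ≤ 1 / 2 := by norm_num
  have h2 : (n : ℝ) ≤ 2 ^ (Nat.log 2 n + 1) := by
    exact_mod_cast (Nat.lt_pow_succ_log_self (by norm_num) n).le
  rw [pow_mul]
  calc 2 * ((127 / 128 : ℝ) ^ 128) ^ (Nat.log 2 n + 1 + 8)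
      ≤ 2 * (1 / 2) ^ (Nat.log 2 n + 1 + 8) := by gcongr
    _ = 1 / (128 * 2 ^ (Nat.log 2 n + 1)) := by
        rw [pow_add _ (Nat.log 2 n + 1) 8, one_div_pow]
        field_simp
        norm_num
    _ ≤ _ := by gcongr

theorem natLog_add_one_le {n : ℕ} (hn : 2 ≤ n) :
    ((Nat.log 2 n + 1 : ℕ) : ℝ) ≤ 3 * Real.log n := by
  have hn' : (2 : ℝ) ≤ n := by exact_mod_cast hn
  have h1 : (2 : ℝ) ^ Nat.log 2 n ≤ n := by
    exact_mod_cast Nat.pow_log_le_self 2 (by omega)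
  have h2 := Real.log_le_log (by positivity) h1
  rw [Real.log_pow] at h2
  have h3 := Real.log_le_log (by norm_num) hn'
  have h4 := Real.log_two_gt_d9
  have h5 : (0 : ℝ) ≤ Nat.log 2 n := Nat.cast_nonneg _
  push_cast
  nlinarith

/-- The number of conditions in `IsGood` is polynomial in `n`. -/
theorem card_conditions_le {n : ℕ} (hn : 2 ≤ n) :
    4 * (n + 1) ^ 2 * (offsets (128 * (Nat.log 2 n + 1 + 8))).card * (2 ^ 18 * n ^ 2)
      ≤ n ^ 38 := by
  have hlog : Nat.log 2 n + 1 ≤ n := Nat.log_lt_self 2 (by omega)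
  have h1 : (offsets (128 * (Nat.log 2 n + 1 + 8))).card ≤ 2 ^ 11 * n :=
    (card_offsets_le _).trans (by omega)
  have h2 : n + 1 ≤ 2 * n := by omega
  calc 4 * (n + 1) ^ 2 * (offsets (128 * (Nat.log 2 n + 1 + 8))).card * (2 ^ 18 * n ^ 2)
      ≤ 4 * (2 * n) ^ 2 * (2 ^ 11 * n) * (2 ^ 18 * n ^ 2) := by gcongr
    _ = 2 ^ 33 * n ^ 5 := by ring
    _ ≤ n ^ 33 * n ^ 5 := by gcongr
    _ = n ^ 38 := by ring

/-- The good event, with the parameters chosen as functions of `n`, implies the bound on the number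
of zeros; when `m > n + 1`, the degree is at most of order `log n` and no condition is needed. -/
theorem numZerosOn_le_log_pow {n b : ℕ} (hn : 2 ≤ n) (hb : 1 ≤ b) {lam : Fin (n + 1) → ℂ}
    (h0 : lam 0 ≠ 0) {L : ℝ} {Γ : Set ℂ} (hL : 0 ≤ L) (hΓ : IsLipschitzCurve L Γ)
    (hgood : b * (Nat.log 2 n + 1) ≤ n + 1 → IsGood (2 ^ 18 * n ^ 2) (b * (Nat.log 2 n + 1))
      (offsets (128 * (Nat.log 2 n + 1 + 8))) lam) :
    numZerosOn Γ (poly lam)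
      ≤ numVertices lam * ((553200 * (2 * ⌈L⌉₊ + 1) * b) * (Nat.log 2 n + 1) ^ 3) := by
  set l := Nat.log 2 n + 1 with hl
  have hl1 : 1 ≤ l := by omega
  have hbl : 1 ≤ b * l := Nat.mul_pos hb hl1
  rcases le_or_gt (b * l) (n + 1) with hm | hm
  · have hn' : (2 : ℝ) ≤ n := by exact_mod_cast hn
    have hm' : ((b * l : ℕ) : ℝ) ≤ n + 1 := by exact_mod_cast hm
    have hK : 2 * Real.pi * (2 * ((b * l : ℕ) : ℝ) + 2) * (8192 * n)
        ≤ ((2 ^ 18 * n ^ 2 : ℕ) : ℝ) := by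
      have hπ := Real.pi_lt_d2
      have h1 : 2 * ((b * l : ℕ) : ℝ) + 2 ≤ 4 * n := by linarith
      calc 2 * Real.pi * (2 * ((b * l : ℕ) : ℝ) + 2) * (8192 * n)
          ≤ 2 * 3.15 * (4 * n) * (8192 * n) := by gcongr
        _ ≤ _ := by push_cast; nlinarith
    have hKe : 2 ^ 18 * n ^ 2 ≤ 2 ^ (18 + 2 * l) := by
      have h1 : n ≤ 2 ^ l := (Nat.lt_pow_succ_log_self (by norm_num) n).le
      calc 2 ^ 18 * n ^ 2 ≤ 2 ^ 18 * (2 ^ l) ^ 2 := by gcongr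
        _ = _ := by rw [← pow_mul, ← pow_add, mul_comm l 2]
    refine (numZerosOn_le_of_isGood (by omega) h0 hL hΓ hbl (hgood hm)
      (two_mul_pow_le (by omega)) hK hKe).trans ?_
    have e1 : 2 * (128 * (l + 8)) + 1 ≤ 2305 * l := by omega
    have e2 : 18 + 2 * l ≤ 20 * l := by omega
    have e3 : 3 * (b * l) + 9 ≤ 12 * (b * l) := by omega
    calc _ ≤ numVertices lam * (2305 * l) * (2 * ⌈L⌉₊ + 1) * ((20 * l) * (12 * (b * l))) := by
          gcongr
      _ = _ := by ring
  · refine (numZerosOn_le_numVertices_mul h0 Γ).trans (Nat.mul_le_mul_left _ ?_)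
    calc n ≤ b * l := by omega
      _ ≤ (553200 * (2 * ⌈L⌉₊ + 1)) * l ^ 2 * (b * l) := Nat.le_mul_of_pos_left _ (by positivity)
      _ = _ := by ring

/-- The bad event has probability at most `n^{-A}`. -/
theorem measureReal_bad_le {Ω : Type*} [MeasurableSpace Ω] {n : ℕ} (hn : 2 ≤ n) {μ : Measure Ω}
    {lam : Ω → Fin (n + 1) → ℂ} (h : PropertyTheta μ lam) (A : ℝ)
    (hm : (⌈A⌉₊ + 38) * (Nat.log 2 n + 1) ≤ n + 1) :
    μ.real {ω | ¬ IsGood (2 ^ 18 * n ^ 2) ((⌈A⌉₊ + 38) * (Nat.log 2 n + 1))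
      (offsets (128 * (Nat.log 2 n + 1 + 8))) (lam ω)} ≤ (n : ℝ) ^ (-A) := by
  set m := (⌈A⌉₊ + 38) * (Nat.log 2 n + 1) with hmdef
  set bad := {ω | ¬ IsGood (2 ^ 18 * n ^ 2) m
      (offsets (128 * (Nat.log 2 n + 1 + 8))) (lam ω)} with hbad
  have hn' : (2 : ℝ) ≤ n := by exact_mod_cast hn
  have hn0 : (0 : ℝ) < n := by linarith
  have h1 : μ bad * 2 ^ m ≤ _ := measure_not_isGood_mul_le h (K := 2 ^ 18 * n ^ 2) (m := m)
    (by nlinarith) (Nat.mul_pos (by omega) (by omega)) hm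
    (offsets (128 * (Nat.log 2 n + 1 + 8)))
  have h2 := ENNReal.toReal_mono (by finiteness) (h1.trans
    (Nat.cast_le.2 (card_conditions_le hn)))
  have h3 : μ.real bad * 2 ^ m ≤ (n : ℝ) ^ 38 := by
    simpa [ENNReal.toReal_mul, measureReal_def] using h2
  have h4 : (n : ℝ) ^ (⌈A⌉₊ + 38) ≤ 2 ^ m := by
    have : n ≤ 2 ^ (Nat.log 2 n + 1) := (Nat.lt_pow_succ_log_self (by norm_num) n).le
    have h5 : (n : ℝ) ≤ 2 ^ (Nat.log 2 n + 1) := by exact_mod_cast this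
    calc (n : ℝ) ^ (⌈A⌉₊ + 38) ≤ (2 ^ (Nat.log 2 n + 1)) ^ (⌈A⌉₊ + 38) := by gcongr
      _ = 2 ^ m := by rw [← pow_mul, hmdef, mul_comm]
  have h5 : μ.real bad * (n : ℝ) ^ ⌈A⌉₊ ≤ 1 := by
    have h6 : μ.real bad * (n : ℝ) ^ ⌈A⌉₊ * (n : ℝ) ^ 38 ≤ 1 * (n : ℝ) ^ 38 := by
      rw [mul_assoc, ← pow_add, one_mul]
      exact (mul_le_mul_of_nonneg_left h4 measureReal_nonneg).trans h3
    exact le_of_mul_le_mul_right h6 (by positivity)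
  calc μ.real bad ≤ ((n : ℝ) ^ ⌈A⌉₊)⁻¹ := by
        rwa [← one_div, le_div_iff₀ (by positivity)]
    _ = (n : ℝ) ^ (-(⌈A⌉₊ : ℝ)) := by rw [Real.rpow_neg hn0.le, Real.rpow_natCast]
    _ ≤ (n : ℝ) ^ (-A) :=
        Real.rpow_le_rpow_of_exponent_le (by linarith) (neg_le_neg (Nat.le_ceil A))

end RandomPoly

theorem theorem1 (A L : ℝ) (hA : 0 < A) (hL : 0 ≤ L) :
    ∃ C : ℝ, 0 < C ∧
      ∀ (n : ℕ), 2 ≤ n →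
      ∀ (Ω : Type*) [MeasurableSpace Ω] (μ : Measure Ω) [IsProbabilityMeasure μ]
        (lam : Ω → Fin (n + 1) → ℂ),
        RandomPoly.PropertyTheta μ lam →
        μ {ω | lam ω 0 = 0} = 0 →
        μ {ω | lam ω (Fin.last n) = 0} = 0 →
        ∃ E : Set Ω, MeasurableSet E ∧ 1 - (n : ℝ) ^ (-A) ≤ μ.real E ∧
          ∀ ω ∈ E, ∀ Γ : Set ℂ, RandomPoly.IsLipschitzCurve L Γ →
            (RandomPoly.numZerosOn Γ (RandomPoly.poly (lam ω)) : ℝ) ≤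
              C * (RandomPoly.numVertices (lam ω) : ℝ) * Real.log n ^ 3 := by
  refine ⟨27 * (553200 * (2 * ⌈L⌉₊ + 1) * (⌈A⌉₊ + 38) : ℕ), by positivity, ?_⟩
  intro n hn Ω _ μ _ lam hΘ h0 _
  set l := Nat.log 2 n + 1 with hl
  set bad : Set Ω := {ω | (⌈A⌉₊ + 38) * l ≤ n + 1 ∧ ¬ RandomPoly.IsGood (2 ^ 18 * n ^ 2)
    ((⌈A⌉₊ + 38) * l) (RandomPoly.offsets (128 * (l + 8))) (lam ω)} with hbad
  have hbad_le : μ.real bad ≤ (n : ℝ) ^ (-A) := by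
    by_cases hm : (⌈A⌉₊ + 38) * l ≤ n + 1
    · simpa only [hbad, hm, true_and] using RandomPoly.measureReal_bad_le hn hΘ A hm
    · simp only [hbad, hm, false_and, Set.ofPred_false, measureReal_empty]
      positivity
  -- the bad event need not be measurable in `Ω`, since `lam` is only a.e. measurable
  refine ⟨(toMeasurable μ (bad ∪ {ω | lam ω 0 = 0}))ᶜ, (measurableSet_toMeasurable _ _).compl,
    ?_, ?_⟩
  · rw [probReal_compl_eq_one_sub (measurableSet_toMeasurable _ _)]
    have h1 : μ.real (toMeasurable μ (bad ∪ {ω | lam ω 0 = 0})) ≤ μ.real bad := by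
      rw [measureReal_def, measure_toMeasurable, measureReal_def]
      refine ENNReal.toReal_mono (by finiteness) ((measure_union_le _ _).trans ?_)
      rw [h0, add_zero]
    linarith
  · intro ω hω Γ hΓ
    have hω' : ω ∉ bad ∪ {ω | lam ω 0 = 0} := fun h => hω (subset_toMeasurable _ _ h)
    rw [Set.mem_union, not_or] at hω'
    have hgood : (⌈A⌉₊ + 38) * l ≤ n + 1 → RandomPoly.IsGood (2 ^ 18 * n ^ 2)
        ((⌈A⌉₊ + 38) * l) (RandomPoly.offsets (128 * (l + 8))) (lam ω) := fun hm => by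
      by_contra h
      exact hω'.1 ⟨hm, h⟩
    have h1 := RandomPoly.numZerosOn_le_log_pow hn (by omega) hω'.2 hL hΓ hgood
    have h2 : ((l : ℕ) : ℝ) ^ 3 ≤ (3 * Real.log n) ^ 3 := by
      gcongr
      exact RandomPoly.natLog_add_one_le hn
    calc (RandomPoly.numZerosOn Γ (RandomPoly.poly (lam ω)) : ℝ)
        ≤ (RandomPoly.numVertices (lam ω) : ℝ)
          * (((553200 * (2 * ⌈L⌉₊ + 1) * (⌈A⌉₊ + 38) : ℕ) : ℝ) * (l : ℝ) ^ 3) := by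
          exact_mod_cast h1
      _ ≤ (RandomPoly.numVertices (lam ω) : ℝ)
          * (((553200 * (2 * ⌈L⌉₊ + 1) * (⌈A⌉₊ + 38) : ℕ) : ℝ) * (3 * Real.log n) ^ 3) := by
          gcongr
      _ = _ := by ring
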